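/- Let $\mathsf X$ be a measurable space with countably generated $\sigma$-field, $\Theta\subseteq\mathbb R^d$, $\theta_0\in\Theta$, and let $P(\theta)$, $\theta\in\Theta$, be Markov transition kernels on $\mathsf X$. Let $e_i$ be the $i$-th unit vector and suppose $\theta_0+he_i\in\Theta$ for all sufficiently small $|h|$ and each $i$. For $\epsilon>0$ put $B_\epsilon(\theta_0)=\{\theta\in\Theta:\max_i|\theta_i-\theta_{0,i}|<\epsilon\}$. For $w:\mathsf X\to[1,\infty)$ put $|g|_w=\sup_x|g(x)|/w(x)$, and for a signed kernel $Q$ put $|||Q|||_V=\sup\{|Qu|_V: u \text{ measurable},\ |u|_V=1\}$, where $Qu(x)=\int u(y)\,Q(x,dy)$. A function of $\theta$ is called differentiable at $\theta_0$ if all its partial derivatives $\partial_i=\partial/\partial\theta_i$, $1\le i\le d$, exist at $\theta_0$; its gradient $\nabla$ is then the vector of these. Assume that for some $\epsilon>0$: (i) $P(\theta)$ is $\psi$-irreducible for every $\theta\in B_\epsilon(\theta_0)$, i.e. there is a nonzero $\sigma$-finite measure $\psi$ such that $\psi(A)>0$ implies that for every $x$ there is an $n$ with $P^n(\theta,x,A)>0$;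 (ii) for $\theta\in B_\epsilon(\theta_0)$ there are nonnegative, jointly measurable densities $p(\theta,x,y)$ with $P(\theta,x,dy)=p(\theta,x,y)P(\theta_0,x,dy)$, and for all $x,y$ the map $\theta\mapsto p(\theta,x,y)$ is differentiable at $\theta_0$; (iii) there are a measurable set $K$, $\delta>0$, $m\ge1$ and a probability measure $\nu$ with $P^m(\theta,x,\cdot)\ge\delta\nu$ for all $x\in K$, $\theta\in B_\epsilon(\theta_0)$; (iv) there are a measurable $V:\mathsf X\to[1,\infty)$ and constants $0<\lambda<1$, $b<\infty$ with $P(\theta)V(x)\le\lambda V(x)+b1_K(x)$ for all $x\in\mathsf X$, $\theta\in B_\epsilon(\theta_0)$; (v) with $P^{(i)}(\theta_0,x,dy)=\partial_i p(\theta_0,x,y)P(\theta_0,x,dy)$ (where $V\,\partial_ip(\theta_0,x,\cdot)$ is $P(\theta_0,x,\cdot)$-integrable for each $x$), $|||P^{(i)}(\theta_0)|||_V<\infty$ and $\lim_{h\to0}\big|\big|\big|\tfrac{P(\theta_0+he_i)-P(\theta_0)}{h}-P^{(i)}(\theta_0)\big|\big|\big|_V=0$ for each $1\le i\le d$; (vi)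 $|g_{ii}|_V<\infty$ for each $1\le i\le d$, where $g_{ii}(x)=\int(\partial_ip(\theta_0,x,y))^2P(\theta_0,x,dy)$; (vii) $f:\mathsf X\to\mathbb R$ is measurable and $|f|_{\sqrt V}<\infty$. Let $\Phi=(\Phi_k)_{k\ge0}$ be a Markov chain with transition kernel $P(\theta_0)$ and initial distribution $\mu$ with $\int V\,d\mu<\infty$, let $E_{\theta_0}$ denote the corresponding expectation, and put $\alpha_n=\frac1n\sum_{j=0}^{n-1}f(\Phi_j)$, $L_n(\theta)=\prod_{j=1}^np(\theta,\Phi_{j-1},\Phi_j)$. Then for every $\theta\in B_\epsilon(\theta_0)$ the kernel $P(\theta)$ has a unique invariant probability measure $\pi(\theta)$, and $f$ is $\pi(\theta)$-integrable; the function $\alpha(\theta)=\int f\,d\pi(\theta)$ is differentiable at $\theta_0$; each $\alpha_n\nabla L_n(\theta_0)$ is integrable; and $$E_{\theta_0}\left[\alpha_n\nabla L_n(\theta_0)\right]\longrightarrow\nabla\alpha(\theta_0)\qquad(n\to\infty).$$ -/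

import Mathlib

open MeasureTheory ProbabilityTheory Filter Topology
open scoped ENNReal

namespace LRGradient

noncomputable section

/-- The weighted supremum norm `sup_x |g x| / w x` of a function given through its absolute value
`|g| : X → [0, ∞]`; the supremum is taken in `[0, ∞]`. -/
def wnorm {X : Type*} (w : X → ℝ) (absg : X → ℝ≥0∞) : ℝ≥0∞ :=
  ⨆ x, absg x / ENNReal.ofReal (w x)

/-- The `V`-operator norm of an operator `T` on functions: the supremum in `[0, ∞]` of `|T u|_V`
over the measurable functions `u` with `|u|_V = 1`. -/
def opNorm {X : Type*} [MeasurableSpace X] (V : X → ℝ) (T : (X → ℝ) → X → ℝ) : ℝ≥0∞ :=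
  ⨆ u : {u : X → ℝ // Measurable u ∧ wnorm V (fun x => ‖u x‖ₑ) = 1},
    wnorm V (fun x => ‖T u.1 x‖ₑ)

/-- The `i`-th partial derivative at `θ` of a function on `ℝ^d`. -/
def partialDeriv {d : ℕ} (i : Fin d) (F : (Fin d → ℝ) → ℝ) (θ : Fin d → ℝ) : ℝ :=
  lineDeriv ℝ F θ (Pi.single i 1)

/-- All partial derivatives of `F` exist at `θ`. -/
def HasGradientAt {d : ℕ} (F : (Fin d → ℝ) → ℝ) (θ : Fin d → ℝ) : Prop :=
  ∀ i : Fin d, LineDifferentiableAt ℝ F θ (Pi.single i 1)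

/-- The gradient, the vector of the partial derivatives. -/
def grad {d : ℕ} (F : (Fin d → ℝ) → ℝ) (θ : Fin d → ℝ) : Fin d → ℝ :=
  fun i => partialDeriv i F θ

/-- The points of the parameter set `Θ` at sup-distance less than `ε` from `θ₀`. -/
def box {d : ℕ} (Θ : Set (Fin d → ℝ)) (θ₀ : Fin d → ℝ) (ε : ℝ) : Set (Fin d → ℝ) :=
  {θ | θ ∈ Θ ∧ ∀ i, |θ i - θ₀ i| < ε}

/-- `ψ`-irreducibility: some nonzero σ-finite measure is an irreducibility measure. -/
def IsPsiIrreducible {X : Type*} [MeasurableSpace X] (κ : Kernel X X) : Prop :=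
  ∃ ψ : Measure X, SigmaFinite ψ ∧ ψ ≠ 0 ∧ Kernel.IsIrreducible ψ κ

/-- Stationary distributions: invariant probability measures. -/
def IsStationary {X : Type*} [MeasurableSpace X] (κ : Kernel X X) (π : Measure X) : Prop :=
  IsProbabilityMeasure π ∧ Kernel.Invariant κ π

open Classical in
/-- The stationary distribution of `κ`; meaningful if there is exactly one. -/
def stationary {X : Type*} [MeasurableSpace X] (κ : Kernel X X) : Measure X :=
  if h : ∃ π, IsStationary κ π then h.choose else 0

/-- The steady-state expectation `α(θ) = π(θ) f`. -/
def steadyState {X : Type*} [MeasurableSpace X] {d : ℕ} (P : (Fin d → ℝ) → Kernel X X)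
    (f : X → ℝ) (θ : Fin d → ℝ) : ℝ :=
  ∫ x, f x ∂(stationary (P θ))

/-- The signed kernel `P^(i)(θ₀, x, dy) = ∂_i p(θ₀, x, y) P(θ₀, x, dy)`, acting on functions. -/
def derivKernel {X : Type*} [MeasurableSpace X] {d : ℕ} (P : (Fin d → ℝ) → Kernel X X)
    (p : (Fin d → ℝ) → X → X → ℝ) (θ₀ : Fin d → ℝ) (i : Fin d) (u : X → ℝ) (x : X) : ℝ :=
  ∫ y, u y * partialDeriv i (fun θ => p θ x y) θ₀ ∂(P θ₀ x)

/-- The difference quotient `(P(θ₀ + h e_i) - P(θ₀)) / h`, acting on functions. -/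
def diffQuot {X : Type*} [MeasurableSpace X] {d : ℕ} (P : (Fin d → ℝ) → Kernel X X)
    (θ₀ : Fin d → ℝ) (i : Fin d) (h : ℝ) (u : X → ℝ) (x : X) : ℝ :=
  ((∫ y, u y ∂(P (θ₀ + h • Pi.single i 1) x)) - ∫ y, u y ∂(P θ₀ x)) / h

/-- The standing assumption on the parametrized family of transition kernels `P`, the densities
`p`, the small set `K` with its constants `δ`, `m` and measure `ν`, the Lyapunov function `V` with
its constants `lam`, `b`, and the cost function `f`. -/
structure StandingAssumption {X : Type*} [MeasurableSpace X] {d : ℕ}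
    (Θ : Set (Fin d → ℝ)) (P : (Fin d → ℝ) → Kernel X X) (p : (Fin d → ℝ) → X → X → ℝ)
    (θ₀ : Fin d → ℝ) (ε : ℝ) (K : Set X) (δ : ℝ) (m : ℕ) (ν : Measure X)
    (V : X → ℝ) (lam b : ℝ) (f : X → ℝ) : Prop where
  eps_pos : 0 < ε
  /-- each `P θ` with `θ ∈ Θ` is a transition kernel -/
  markov : ∀ θ ∈ Θ, IsMarkovKernel (P θ)
  mem : θ₀ ∈ Θ
  /-- the parameters `θ₀ + h e_i` are admissible for all small `h` -/
  axes : ∀ i : Fin d, ∀ᶠ h : ℝ in 𝓝 0, θ₀ + h • Pi.single i 1 ∈ Θ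
  irreducible : ∀ θ ∈ box Θ θ₀ ε, IsPsiIrreducible (P θ)
  density_measurable : ∀ θ ∈ box Θ θ₀ ε, Measurable (Function.uncurry (p θ))
  density_nonneg : ∀ θ ∈ box Θ θ₀ ε, ∀ x y, 0 ≤ p θ x y
  density : ∀ θ ∈ box Θ θ₀ ε, ∀ x,
    P θ x = (P θ₀ x).withDensity (fun y => ENNReal.ofReal (p θ x y))
  density_differentiable : ∀ x y, HasGradientAt (fun θ => p θ x y) θ₀
  small_measurable : MeasurableSet K
  delta_pos : 0 < δ
  one_le_m : 1 ≤ m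
  prob : IsProbabilityMeasure ν
  small : ∀ θ ∈ box Θ θ₀ ε, ∀ x ∈ K, ENNReal.ofReal δ • ν ≤ (P θ ^ m) x
  V_measurable : Measurable V
  one_le_V : ∀ x, 1 ≤ V x
  lam_pos : 0 < lam
  lam_lt_one : lam < 1
  drift : ∀ θ ∈ box Θ θ₀ ε, ∀ x,
    ∫⁻ y, ENNReal.ofReal (V y) ∂(P θ x) ≤ ENNReal.ofReal (lam * V x + K.indicator (fun _ => b) x)
  /-- the signed measures `P^(i)(θ₀, x, ·)` act on all functions bounded by a multiple of `V` -/
  deriv_integrable : ∀ i : Fin d, ∀ x,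
    Integrable (fun y => V y * partialDeriv i (fun θ => p θ x y) θ₀) (P θ₀ x)
  deriv_bounded : ∀ i : Fin d, opNorm V (derivKernel P p θ₀ i) < ∞
  deriv_limit : ∀ i : Fin d, Tendsto
    (fun h : ℝ => opNorm V (fun u x => diffQuot P θ₀ i h u x - derivKernel P p θ₀ i u x))
    (𝓝[≠] 0) (𝓝 0)
  /-- `|g_ii|_V < ∞` -/
  fisher_bounded : ∀ i : Fin d, wnorm V (fun x =>
    ∫⁻ y, ENNReal.ofReal ((partialDeriv i (fun θ => p θ x y) θ₀) ^ 2) ∂(P θ₀ x)) < ∞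
  f_measurable : Measurable f
  f_bounded : wnorm (fun x => √(V x)) (fun x => ‖f x‖ₑ) < ∞

/-- Under `Pr`, the process `Φ` is a Markov chain with transition kernel `κ` and initial
distribution `μ`. The field `markov` says that the conditional probability of `Φ (n + 1) ∈ A` given
`σ(Φ 0, …, Φ n)` is `κ (Φ n) A`. -/
structure IsMarkovChain {Ω X : Type*} [MeasurableSpace Ω] [MeasurableSpace X]
    (Pr : Measure Ω) (κ : Kernel X X) (μ : Measure X) (Φ : ℕ → Ω → X) : Prop where
  measurable : ∀ n, Measurable (Φ n)
  initial : Pr.map (Φ 0) = μ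
  markov : ∀ (n : ℕ) (B : Set Ω) (A : Set X),
    MeasurableSet[⨆ j ∈ Finset.range (n + 1), MeasurableSpace.comap (Φ j) inferInstance] B →
    MeasurableSet A → Pr (B ∩ Φ (n + 1) ⁻¹' A) = ∫⁻ ω in B, κ (Φ n ω) A ∂Pr

/-- The time average `α_n = n⁻¹ ∑_{j < n} f(Φ_j)`. -/
def timeAverage {Ω X : Type*} (f : X → ℝ) (Φ : ℕ → Ω → X) (n : ℕ) (ω : Ω) : ℝ :=
  (1 / (n : ℝ)) * ∑ j ∈ Finset.range n, f (Φ j ω)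

/-- The likelihood ratio `L_n(θ) = ∏_{j=1}^n p(θ, Φ_{j-1}, Φ_j)`. -/
def likelihoodRatio {Ω X : Type*} {d : ℕ} (p : (Fin d → ℝ) → X → X → ℝ) (Φ : ℕ → Ω → X)
    (n : ℕ) (θ : Fin d → ℝ) (ω : Ω) : ℝ :=
  ∏ j ∈ Finset.range n, p θ (Φ j ω) (Φ (j + 1) ω)

end

end LRGradient

/-!
Everything is read off a solution `g`, bounded by a multiple of `√V`, of the Poisson equation
`g - P(θ₀) g = f - α(θ₀)`.

Integrating this equation against `π(θ)` gives `α(θ) - α(θ₀) = π(θ) (P(θ) - P(θ₀)) g`, hence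
`∂_i α(θ₀) = π(θ₀) P^(i) g`. On the other hand, `n α_n` is the sum of `n α(θ₀) + g(Φ_0) - g(Φ_n)`
and the martingale with increments `g(Φ_{k+1}) - P(θ₀) g(Φ_k)`, while `∂_i L_n(θ₀)` is the
martingale whose increments are the scores, with second moment `O(n)`. Orthogonality of martingale
increments turns `E[α_n ∂_i L_n(θ₀)]` into the average of `E[P^(i) g(Φ_k)]`, `k < n`, which tends
to `π(θ₀) P^(i) g`, up to `E[g(Φ_n) ∂_i L_n(θ₀)] / n = O(n^(-1/2))`.

Neither existence of `π(θ)` nor the Poisson equation requires aperiodicity: the drift and the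
minorization make a Cesàro average of powers of `P(θ)` contract weighted oscillations.
-/

namespace LRGradient

noncomputable section

variable {X : Type*} [MeasurableSpace X]

section Weight

/-- A weight for weighted supremum norms: a measurable function bounded below by one. -/
structure IsWeight (V : X → ℝ) : Prop where
  measurable : Measurable V
  one_le : ∀ x, 1 ≤ V x

/-- The space `{φ | |φ|_V < ∞}` of measurable functions dominated by a multiple of `V`. -/
def wBounded (V : X → ℝ) : Submodule ℝ (X → ℝ) where
  carrier := {φ | Measurable φ ∧ ∃ M, ∀ x, |φ x| ≤ M * V x}
  add_mem' := by
    rintro φ ψ ⟨hφ, M, hM⟩ ⟨hψ, N, hN⟩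
    refine ⟨hφ.add hψ, M + N, fun x => (abs_add_le _ _).trans ?_⟩
    linarith [hM x, hN x]
  zero_mem' := ⟨measurable_const, 0, fun x => by simp⟩
  smul_mem' := by
    rintro c φ ⟨hφ, M, hM⟩
    refine ⟨hφ.const_smul c, |c| * M, fun x => ?_⟩
    simpa only [Pi.smul_apply, smul_eq_mul, abs_mul, mul_assoc] using
      mul_le_mul_of_nonneg_left (hM x) (abs_nonneg c)

instance (V : X → ℝ) : CoeFun (wBounded V) (fun _ => X → ℝ) := ⟨fun φ => φ.1⟩

variable {V : X → ℝ}

lemma wBounded_measurable (φ : wBounded V) : Measurable φ := φ.2.1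

lemma wBounded_integrable (φ : wBounded V) {ρ : Measure X} (hρ : Integrable V ρ) :
    Integrable φ ρ := by
  obtain ⟨M, hM⟩ := φ.2.2
  exact (hρ.const_mul M).mono' (wBounded_measurable φ).aestronglyMeasurable (ae_of_all _ hM)

namespace IsWeight

variable (hV : IsWeight V)
include hV

lemma pos (x : X) : 0 < V x := zero_lt_one.trans_le (hV.one_le x)

lemma integrable_iff_lintegral_lt_top {ρ : Measure X} :
    Integrable V ρ ↔ ∫⁻ y, ENNReal.ofReal (V y) ∂ρ < ∞ := by
  rw [← hasFiniteIntegral_iff_ofReal (ae_of_all _ fun x => (hV.pos x).le)]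
  exact ⟨fun h => h.2, fun h => ⟨hV.measurable.aestronglyMeasurable, h⟩⟩

lemma integral_le_of_lintegral_le {ρ : Measure X} {c : ℝ} (hc : 0 ≤ c)
    (h : ∫⁻ y, ENNReal.ofReal (V y) ∂ρ ≤ ENNReal.ofReal c) : ∫ y, V y ∂ρ ≤ c := by
  rw [integral_eq_lintegral_of_nonneg_ae (ae_of_all _ fun y => (hV.pos y).le)
    hV.measurable.aestronglyMeasurable]
  exact ENNReal.toReal_le_of_le_ofReal hc h

lemma exists_abs_le (φ : wBounded V) : ∃ M, 0 ≤ M ∧ ∀ x, |φ x| ≤ M * V x := by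
  obtain ⟨M, hM⟩ := φ.2.2
  refine ⟨max M 0, le_max_right _ _, fun x => (hM x).trans ?_⟩
  exact mul_le_mul_of_nonneg_right (le_max_left _ _) (hV.pos x).le

/-- `V` as an element of the space it defines. -/
def self : wBounded V := ⟨V, hV.measurable, 1, fun x => by simp [abs_of_pos (hV.pos x)]⟩

/-- The constant function `1` as an element of `wBounded V`. -/
def one : wBounded V := ⟨fun _ => 1, measurable_const, 1, fun x => by simpa using hV.one_le x⟩

/-- The indicator function of a measurable set as an element of `wBounded V`. -/
def indicator {A : Set X} (hA : MeasurableSet A) : wBounded V :=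
  ⟨A.indicator 1, measurable_const.indicator hA, 1, fun x => by
    have h0 : 0 ≤ A.indicator (1 : X → ℝ) x := Set.indicator_nonneg (fun _ _ => zero_le_one) x
    have h1 : A.indicator (1 : X → ℝ) x ≤ 1 := Set.indicator_le_self' (fun _ _ => zero_le_one) x
    simpa only [one_mul, abs_of_nonneg h0] using h1.trans (hV.one_le x)⟩

@[simp] lemma one_apply (x : X) : hV.one x = 1 := rfl

lemma indicator_apply {A : Set X} (hA : MeasurableSet A) (x : X) :
    hV.indicator hA x = A.indicator 1 x := rfl

lemma integral_indicator {A : Set X} (hA : MeasurableSet A) (ρ : Measure X) :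
    ∫ x, hV.indicator hA x ∂ρ = ρ.real A :=
  integral_indicator_one hA

lemma measure_eq_of_integral_eq {π σ : Measure X} [IsFiniteMeasure π] [IsFiniteMeasure σ]
    (h : ∀ φ : wBounded V, ∫ x, φ x ∂π = ∫ x, φ x ∂σ) : π = σ := by
  refine Measure.ext fun A hA => ?_
  have := h (hV.indicator hA)
  rw [hV.integral_indicator, hV.integral_indicator] at this
  exact (measureReal_eq_measureReal_iff (measure_ne_top _ _) (measure_ne_top _ _)).1 this

end IsWeight

end Weight

section AffineDrift

lemma isMarkovKernel_pow (κ : Kernel X X) [IsMarkovKernel κ] (n : ℕ) : IsMarkovKernel (κ ^ n) := by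
  induction n with
  | zero => exact inferInstanceAs (IsMarkovKernel (Kernel.id : Kernel X X))
  | succ n ih => rw [pow_succ]; exact inferInstanceAs (IsMarkovKernel ((κ ^ n) ∘ₖ κ))

lemma kernel_pow_zero_apply (κ : Kernel X X) (x : X) : (κ ^ 0) x = Measure.dirac x := by
  rw [pow_zero]
  exact Kernel.id_apply x

lemma kernel_pow_succ_apply (κ : Kernel X X) (n : ℕ) (x : X) :
    (κ ^ (n + 1)) x = ((κ ^ n) x).bind κ := by
  rw [pow_succ']
  exact Kernel.comp_apply κ (κ ^ n) x

/-- The drift inequality `κV ≤ lam V + C` for a Markov kernel `κ` and a weight `V`. -/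
structure AffineDrift (κ : Kernel X X) (V : X → ℝ) (lam C : ℝ) : Prop where
  isMarkovKernel : IsMarkovKernel κ
  isWeight : IsWeight V
  lam_nonneg : 0 ≤ lam
  const_nonneg : 0 ≤ C
  lintegral_le : ∀ x, ∫⁻ y, ENNReal.ofReal (V y) ∂(κ x) ≤ ENNReal.ofReal (lam * V x + C)

namespace AffineDrift

variable {κ : Kernel X X} {V : X → ℝ} {lam C : ℝ} (H : AffineDrift κ V lam C)
include H

lemma integrable_kernel (x : X) : Integrable V (κ x) :=
  H.isWeight.integrable_iff_lintegral_lt_top.2 ((H.lintegral_le x).trans_lt ENNReal.ofReal_lt_top)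

lemma integral_le (x : X) : ∫ y, V y ∂(κ x) ≤ lam * V x + C :=
  H.isWeight.integral_le_of_lintegral_le
    (add_nonneg (mul_nonneg H.lam_nonneg (H.isWeight.pos x).le) H.const_nonneg) (H.lintegral_le x)

lemma lintegral_bind_le (ρ : Measure X) :
    ∫⁻ y, ENNReal.ofReal (V y) ∂(ρ.bind κ)
      ≤ ENNReal.ofReal lam * ∫⁻ x, ENNReal.ofReal (V x) ∂ρ + ENNReal.ofReal C * ρ Set.univ := by
  have hV := H.isWeight.measurable.ennreal_ofReal
  rw [Measure.lintegral_bind κ.aemeasurable hV.aemeasurable]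
  calc ∫⁻ x, ∫⁻ y, ENNReal.ofReal (V y) ∂(κ x) ∂ρ
      ≤ ∫⁻ x, (ENNReal.ofReal lam * ENNReal.ofReal (V x) + ENNReal.ofReal C) ∂ρ := by
        refine lintegral_mono fun x => (H.lintegral_le x).trans_eq ?_
        rw [ENNReal.ofReal_add (mul_nonneg H.lam_nonneg (H.isWeight.pos x).le) H.const_nonneg,
          ENNReal.ofReal_mul H.lam_nonneg]
    _ = _ := by rw [lintegral_add_right _ measurable_const, lintegral_const_mul _ hV,
          lintegral_const]

lemma integrable_bind {ρ : Measure X} [IsFiniteMeasure ρ] (hρ : Integrable V ρ) :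
    Integrable V (ρ.bind κ) := by
  rw [H.isWeight.integrable_iff_lintegral_lt_top] at hρ ⊢
  refine (H.lintegral_bind_le ρ).trans_lt (ENNReal.add_lt_top.2 ⟨?_, ?_⟩)
  · exact ENNReal.mul_lt_top ENNReal.ofReal_lt_top hρ
  · exact ENNReal.mul_lt_top ENNReal.ofReal_lt_top (measure_lt_top ρ _)

lemma pow (hlam : lam < 1) (n : ℕ) : AffineDrift (κ ^ n) V (lam ^ n) (C / (1 - lam)) where
  isMarkovKernel := have := H.isMarkovKernel; isMarkovKernel_pow κ n
  isWeight := H.isWeight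
  lam_nonneg := pow_nonneg H.lam_nonneg n
  const_nonneg := div_nonneg H.const_nonneg (by linarith)
  lintegral_le x := by
    have := H.isMarkovKernel
    have hD : 0 ≤ C / (1 - lam) := div_nonneg H.const_nonneg (by linarith)
    have hfix : lam * (C / (1 - lam)) + C = C / (1 - lam) := by
      have : 1 - lam ≠ 0 := by linarith
      field_simp
      ring
    induction n with
    | zero =>
      rw [kernel_pow_zero_apply, lintegral_dirac' _ H.isWeight.measurable.ennreal_ofReal]
      exact ENNReal.ofReal_le_ofReal (by simpa using hD)
    | succ n ih =>
      have := isMarkovKernel_pow κ n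
      have hn : 0 ≤ lam ^ n * V x + C / (1 - lam) :=
        add_nonneg (mul_nonneg (pow_nonneg H.lam_nonneg n) (H.isWeight.pos x).le) hD
      rw [kernel_pow_succ_apply]
      refine (H.lintegral_bind_le _).trans ?_
      rw [measure_univ, mul_one]
      calc _ ≤ ENNReal.ofReal lam * ENNReal.ofReal (lam ^ n * V x + C / (1 - lam))
              + ENNReal.ofReal C := by gcongr
        _ = ENNReal.ofReal (lam * (lam ^ n * V x + C / (1 - lam)) + C) := by
            rw [← ENNReal.ofReal_mul H.lam_nonneg,
              ENNReal.ofReal_add (mul_nonneg H.lam_nonneg hn) H.const_nonneg]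
        _ = _ := by
            congr 1
            linear_combination hfix

lemma integral_mem_wBounded {φ : X → ℝ} (hφ : φ ∈ wBounded V) :
    (fun x => ∫ y, φ y ∂(κ x)) ∈ wBounded V := by
  have := H.isMarkovKernel
  obtain ⟨M, hM0, hM⟩ := H.isWeight.exists_abs_le ⟨φ, hφ⟩
  refine ⟨(hφ.1.stronglyMeasurable.integral_kernel (κ := κ)).measurable, M * (lam + C),
    fun x => ?_⟩
  calc |∫ y, φ y ∂(κ x)| ≤ ∫ y, M * V y ∂(κ x) := by
        rw [← Real.norm_eq_abs]
        exact norm_integral_le_of_norm_le ((H.integrable_kernel x).const_mul M) (ae_of_all _ hM)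
    _ = M * ∫ y, V y ∂(κ x) := integral_const_mul _ _
    _ ≤ M * (lam * V x + C * V x) := by
        refine mul_le_mul_of_nonneg_left ((H.integral_le x).trans ?_) hM0
        gcongr
        exact le_mul_of_one_le_right H.const_nonneg (H.isWeight.one_le x)
    _ = M * (lam + C) * V x := by ring

/-- The transition operator `φ ↦ κφ` on `wBounded V`. -/
def op : Module.End ℝ (wBounded V) where
  toFun φ := ⟨fun x => ∫ y, φ y ∂(κ x), H.integral_mem_wBounded φ.2⟩
  map_add' φ ψ := by
    ext x
    exact integral_add (wBounded_integrable φ (H.integrable_kernel x))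
      (wBounded_integrable ψ (H.integrable_kernel x))
  map_smul' c φ := by
    ext x
    exact integral_const_mul c _

lemma op_apply (φ : wBounded V) (x : X) : H.op φ x = ∫ y, φ y ∂(κ x) := rfl

lemma op_one : H.op H.isWeight.one = H.isWeight.one := by
  have := H.isMarkovKernel
  ext x
  simp [op_apply]

lemma abs_op_le {φ ψ : wBounded V} (h : ∀ x, |φ x| ≤ ψ x) (x : X) : |H.op φ x| ≤ H.op ψ x := by
  rw [← Real.norm_eq_abs]
  exact norm_integral_le_of_norm_le (wBounded_integrable ψ (H.integrable_kernel x)) (ae_of_all _ h)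

lemma integral_bind {ρ : Measure X} [IsFiniteMeasure ρ] (hρ : Integrable V ρ) (φ : wBounded V) :
    ∫ x, φ x ∂(ρ.bind κ) = ∫ x, H.op φ x ∂ρ := by
  have h := wBounded_integrable φ (H.integrable_bind hρ)
  rw [Measure.comp_eq_comp_const_apply] at h ⊢
  rw [Kernel.integral_comp h]
  rfl

lemma op_pow_apply (hlam : lam < 1) (n : ℕ) (φ : wBounded V) (x : X) :
    (H.op ^ n) φ x = ∫ y, φ y ∂((κ ^ n) x) := by
  have := H.isMarkovKernel
  induction n generalizing φ with
  | zero =>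
    rw [kernel_pow_zero_apply, integral_dirac' _ _ (wBounded_measurable φ).stronglyMeasurable]
    rfl
  | succ n ih =>
    have := isMarkovKernel_pow κ n
    rw [kernel_pow_succ_apply, H.integral_bind ((H.pow hlam n).integrable_kernel x), ← ih,
      pow_succ, Module.End.mul_apply]

lemma invariant_iff_integral_op {π : Measure X} [IsFiniteMeasure π] (hπ : Integrable V π) :
    Kernel.Invariant κ π ↔ ∀ φ : wBounded V, ∫ x, H.op φ x ∂π = ∫ x, φ x ∂π := by
  have := H.isMarkovKernel
  refine ⟨fun h φ => by rw [← H.integral_bind hπ, h.def], fun h => ?_⟩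
  exact H.isWeight.measure_eq_of_integral_eq fun φ => (H.integral_bind hπ φ).trans (h φ)

end AffineDrift

end AffineDrift

section Contraction

variable {V : X → ℝ} {β M : ℝ}

/-- The oscillation of `φ` relative to the weight `2 + β (V x + V y)` is at most `M`. These are the
seminorms which a kernel with drift and minorization contracts (Hairer and Mattingly). -/
def HasOscBound (V : X → ℝ) (β M : ℝ) (φ : X → ℝ) : Prop :=
  ∀ x y, |φ x - φ y| ≤ M * (2 + β * (V x + V y))

lemma IsWeight.two_add_pos (hV : IsWeight V) (hβ : 0 ≤ β) (x y : X) :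
    0 < 2 + β * (V x + V y) := by
  have := hV.pos x
  have := hV.pos y
  positivity

lemma HasOscBound.nonneg {φ : X → ℝ} (h : HasOscBound V β M φ) (hV : IsWeight V) (hβ : 0 ≤ β)
    (x : X) : 0 ≤ M :=
  nonneg_of_mul_nonneg_left ((abs_nonneg _).trans (h x x)) (hV.two_add_pos hβ x x)

lemma IsWeight.exists_hasOscBound (hV : IsWeight V) (hβ : 0 < β) (φ : wBounded V) :
    ∃ M, HasOscBound V β M φ := by
  obtain ⟨M, hM0, hM⟩ := hV.exists_abs_le φ
  refine ⟨M / β, fun x y => ?_⟩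
  calc |φ x - φ y| ≤ |φ x| + |φ y| := abs_sub _ _
    _ ≤ M * V x + M * V y := add_le_add (hM x) (hM y)
    _ = M / β * (0 + β * (V x + V y)) := by field_simp; ring
    _ ≤ M / β * (2 + β * (V x + V y)) := by gcongr; norm_num

lemma IsWeight.hasOscBound_indicator (hV : IsWeight V) (hβ : 0 ≤ β) {A : Set X}
    (hA : MeasurableSet A) : HasOscBound V β 1 (hV.indicator hA) := by
  intro x y
  have h1 : |hV.indicator hA x - hV.indicator hA y| ≤ 1 := by
    rw [hV.indicator_apply, hV.indicator_apply]
    by_cases hx : x ∈ A <;> by_cases hy : y ∈ A <;> simp [hx, hy]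
  have : 0 ≤ β * (V x + V y) := mul_nonneg hβ (add_nonneg (hV.pos x).le (hV.pos y).le)
  linarith

/-- The midpoint of the intervals `[φ x - w x, φ x + w x]`, which intersect pairwise. -/
lemma exists_abs_sub_le_of_osc_le {Y : Type*} [Nonempty Y] {φ w : Y → ℝ}
    (h : ∀ x y, |φ x - φ y| ≤ w x + w y) : ∃ c, ∀ x, |φ x - c| ≤ w x := by
  have hle (x y : Y) : φ x - w x ≤ φ y + w y := by linarith [le_abs_self (φ x - φ y), h x y]
  have hbdd : BddAbove (Set.range fun x => φ x - w x) := by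
    obtain ⟨y⟩ := ‹Nonempty Y›
    exact ⟨φ y + w y, Set.forall_mem_range.2 fun x => hle x y⟩
  refine ⟨⨆ x, (φ x - w x), fun x => abs_le.2 ⟨?_, ?_⟩⟩
  · linarith [ciSup_le fun y => hle y x]
  · linarith [le_ciSup hbdd x]

lemma abs_integral_sub_integral_le_of_measure_le {ρ σ : Measure X} (hσ : σ ≤ ρ) {ψ w : X → ℝ}
    (hψ : Integrable ψ ρ) (hw : Integrable w ρ) (h : ∀ x, |ψ x| ≤ w x) :
    |∫ x, ψ x ∂ρ - ∫ x, ψ x ∂σ| ≤ ∫ x, w x ∂ρ - ∫ x, w x ∂σ := by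
  have hsub := integral_mono_measure hσ
    (ae_of_all _ fun x => sub_nonneg.2 (abs_le.1 (h x)).2) (hw.sub hψ)
  have hadd := integral_mono_measure hσ
    (ae_of_all _ fun x => neg_le_iff_add_nonneg'.1 (abs_le.1 (h x)).1) (hw.add hψ)
  rw [integral_sub (hw.mono_measure hσ) (hψ.mono_measure hσ), integral_sub hw hψ] at hsub
  rw [integral_add (hw.mono_measure hσ) (hψ.mono_measure hσ), integral_add hw hψ] at hadd
  exact abs_le.2 ⟨by linarith, by linarith⟩

lemma exists_contraction_rate {γ C η R : ℝ} (hγ : γ < 1) (hC : 0 ≤ C) (hγ0 : 0 ≤ γ)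
    (hη : 0 < η) (hR : 4 * C < (1 - γ) * R) :
    ∃ a β, 0 ≤ a ∧ a < 1 ∧ 0 < β ∧
      (∀ s, 0 ≤ s → 2 + β * (γ * s + 2 * C) - 2 * η ≤ a * (2 + β * s)) ∧
      ∀ s, R < s → 2 + β * (γ * s + 2 * C) ≤ a * (2 + β * s) := by
  have hγ' : 0 < 1 - γ := sub_pos.2 hγ
  have hR0 : 0 < R := pos_of_mul_pos_right (by linarith) hγ'.le
  obtain ⟨β, hβ, hβC⟩ : ∃ β, 0 < β ∧ 2 * (β * C) ≤ η := by
    refine ⟨η / (2 * (C + 1)), by positivity, ?_⟩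
    rw [← mul_assoc, mul_div_assoc', div_mul_eq_mul_div, div_le_iff₀ (by positivity)]
    nlinarith
  obtain ⟨t, ht, htη, htγ, htR⟩ :
      ∃ t, 0 < t ∧ 2 * t ≤ η ∧ 4 * t ≤ 1 - γ ∧ 8 * t ≤ β * (1 - γ) * R := by
    refine ⟨min (η / 2) (min ((1 - γ) / 4) (β * (1 - γ) * R / 8)), by positivity, ?_, ?_, ?_⟩
    · linarith [min_le_left (η / 2) (min ((1 - γ) / 4) (β * (1 - γ) * R / 8))]
    · linarith [(min_le_right (η / 2) _).trans (min_le_left ((1 - γ) / 4) (β * (1 - γ) * R / 8))]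
    · linarith [(min_le_right (η / 2) _).trans (min_le_right ((1 - γ) / 4) (β * (1 - γ) * R / 8))]
  refine ⟨1 - t, β, by linarith, by linarith, hβ, fun s hs => ?_, fun s hs => ?_⟩
  · have : t * (β * s) ≤ (1 - γ) * (β * s) := by gcongr; linarith
    linarith
  · have hs0 : 0 < s := hR0.trans hs
    have htail : β * (4 * C) ≤ β * ((1 - γ) * s) :=
      mul_le_mul_of_nonneg_left (hR.le.trans (mul_le_mul_of_nonneg_left hs.le hγ'.le)) hβ.le
    have hRs : β * (1 - γ) * R ≤ β * (1 - γ) * s := by gcongr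
    have : 4 * t * (β * s) ≤ (1 - γ) * (β * s) := by gcongr
    linarith

/-- A Markov operator which contracts the weighted oscillations at rate `a`. -/
structure ContractsOsc (V : X → ℝ) (T : Module.End ℝ (wBounded V)) (a β : ℝ) : Prop where
  nonneg : 0 ≤ a
  lt_one : a < 1
  pos : 0 < β
  hasOscBound : ∀ {M : ℝ} {φ : wBounded V}, HasOscBound V β M φ → HasOscBound V β (a * M) (T φ)

lemma ContractsOsc.hasOscBound_pow {T : Module.End ℝ (wBounded V)} {a : ℝ}
    (hT : ContractsOsc V T a β) {φ : wBounded V} (hφ : HasOscBound V β M φ) (k : ℕ) :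
    HasOscBound V β (a ^ k * M) ((T ^ k) φ) := by
  induction k with
  | zero => simpa using hφ
  | succ k ih =>
    rw [pow_succ' a, mul_assoc, pow_succ' T]
    exact hT.hasOscBound ih

namespace AffineDrift

variable {κ : Kernel X X} {lam C : ℝ} (H : AffineDrift κ V lam C)
include H

/-- Mass which `κ x` and `κ y` have in common does not contribute to the oscillation of `κφ`. -/
lemma abs_op_sub_op_le (hβ : 0 ≤ β) {φ : wBounded V} (hφ : HasOscBound V β M φ) {x y : X}
    {σ : Measure X} (hx : σ ≤ κ x) (hy : σ ≤ κ y) :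
    |H.op φ x - H.op φ y|
      ≤ M * (2 + β * (lam * (V x + V y) + 2 * C) - 2 * σ.real Set.univ) := by
  have := H.isMarkovKernel
  have hM := hφ.nonneg H.isWeight hβ x
  have hVσ : Integrable V σ := (H.integrable_kernel x).mono_measure hx
  have : IsFiniteMeasure σ := isFiniteMeasure_of_le _ hx
  let w : wBounded V := M • (H.isWeight.one + β • H.isWeight.self)
  have hw (z : X) : w z = M * (1 + β * V z) := rfl
  have : Nonempty X := ⟨x⟩
  obtain ⟨c, hc⟩ := exists_abs_sub_le_of_osc_le (φ := φ) (w := w) fun z z' => by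
    rw [hw, hw]
    exact (hφ z z').trans_eq (by ring)
  let ψ : wBounded V := φ - c • H.isWeight.one
  have hψ (z : X) : |ψ z| ≤ w z := by simpa [ψ] using hc z
  have hopψ (z : X) : H.op ψ z = H.op φ z - c := by simp [ψ, H.op_one]
  have hopw (z : X) : H.op w z ≤ M * (1 + β * (lam * V z + C)) := by
    have : H.op w z = M * (1 + β * ∫ y, V y ∂(κ z)) := by
      simp only [w, map_smul, map_add, H.op_one]
      rfl
    rw [this]
    gcongr
    exact H.integral_le z
  have hσw : M * σ.real Set.univ ≤ ∫ z, w z ∂σ := by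
    have hle : ∫ _, M ∂σ ≤ ∫ z, w z ∂σ := by
      refine integral_mono (integrable_const M) (wBounded_integrable w hVσ) fun z => ?_
      rw [hw]
      exact le_mul_of_one_le_right hM (by linarith [mul_nonneg hβ (H.isWeight.pos z).le])
    simpa [mul_comm] using hle
  have hclose {z : X} (hz : σ ≤ κ z) :
      |H.op φ z - c - ∫ z, ψ z ∂σ| ≤ M * (1 + β * (lam * V z + C)) - M * σ.real Set.univ := by
    rw [← hopψ]
    refine (abs_integral_sub_integral_le_of_measure_le hz (wBounded_integrable ψ
      (H.integrable_kernel z)) (wBounded_integrable w (H.integrable_kernel z)) hψ).trans ?_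
    exact sub_le_sub (hopw z) hσw
  have hcx := abs_le.1 (hclose hx)
  have hcy := abs_le.1 (hclose hy)
  exact abs_le.2 ⟨by linarith [hcx.1, hcy.2], by linarith [hcx.2, hcy.1]⟩

theorem exists_contractsOsc (hlam : lam < 1) {η R : ℝ} (hη : 0 < η) {ν : Measure X}
    [IsProbabilityMeasure ν] (hR : 4 * C < (1 - lam) * R)
    (hmin : ∀ x, V x ≤ R → ENNReal.ofReal η • ν ≤ κ x) : ∃ a β, ContractsOsc V H.op a β := by
  obtain ⟨a, β, ha0, ha1, hβ, hsmall, hlarge⟩ :=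
    exists_contraction_rate hlam H.const_nonneg H.lam_nonneg hη hR
  refine ⟨a, β, ha0, ha1, hβ, fun {M φ} hφ x y => ?_⟩
  have hM := hφ.nonneg H.isWeight hβ.le x
  have hVx := H.isWeight.pos x
  have hVy := H.isWeight.pos y
  rw [mul_comm a, mul_assoc]
  rcases le_or_gt (V x + V y) R with hxy | hxy
  · refine (H.abs_op_sub_op_le hβ.le hφ (hmin x (by linarith)) (hmin y (by linarith))).trans ?_
    have hmass : (ENNReal.ofReal η • ν).real Set.univ = η := by simp [hη.le]
    rw [hmass]
    exact mul_le_mul_of_nonneg_left (hsmall _ (add_pos hVx hVy).le) hM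
  · refine (H.abs_op_sub_op_le hβ.le hφ (Measure.zero_le _) (Measure.zero_le _)).trans ?_
    simpa using mul_le_mul_of_nonneg_left (hlarge _ hxy) hM

end AffineDrift

end Contraction

section SetwiseLimit

/-- Uniformity over sets lets the limits over `k` and over partial unions be interchanged. -/
lemma hasSum_of_uniform_limit {ρ : ℕ → Measure X} [∀ k, IsFiniteMeasure (ρ k)] {L : Set X → ℝ}
    {e : ℕ → ℝ} (he : Tendsto e atTop (𝓝 0))
    (h : ∀ k A, MeasurableSet A → |(ρ k).real A - L A| ≤ e k) {A : ℕ → Set X}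
    (hA : ∀ i, MeasurableSet (A i)) (hd : Pairwise (Function.onFun Disjoint A)) :
    HasSum (fun i => L (A i)) (L (⋃ i, A i)) := by
  have hlim {B : Set X} (hB : MeasurableSet B) : Tendsto (fun k => (ρ k).real B) atTop (𝓝 (L B)) :=
    tendsto_iff_dist_tendsto_zero.2 (squeeze_zero (fun _ => dist_nonneg) (fun k => h k B hB) he)
  have hunion (s : Finset ℕ) : MeasurableSet (⋃ i ∈ s, A i) :=
    s.measurableSet_biUnion fun i _ => hA i
  have hfin (k : ℕ) (s : Finset ℕ) : ∑ i ∈ s, (ρ k).real (A i) = (ρ k).real (⋃ i ∈ s, A i) :=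
    (measureReal_biUnion_finset (fun i _ j _ hij => hd hij) (fun i _ => hA i)).symm
  have hadd (s : Finset ℕ) : ∑ i ∈ s, L (A i) = L (⋃ i ∈ s, A i) :=
    tendsto_nhds_unique (tendsto_finsetSum s fun i _ => hlim (hA i))
      ((hlim (hunion s)).congr fun k => (hfin k s).symm)
  have hk (k : ℕ) : HasSum (fun i => (ρ k).real (A i)) ((ρ k).real (⋃ i, A i)) := by
    have hsum : ∑' i, ρ k (A i) = ρ k (⋃ i, A i) := (measure_iUnion hd hA).symm
    rw [measureReal_def, ← hsum, ENNReal.tsum_toReal_eq fun i => measure_ne_top _ _]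
    exact (ENNReal.summable_toReal (hsum ▸ measure_ne_top _ _)).hasSum
  refine TendstoUniformlyOnFilter.tendsto_of_eventually_tendsto (p := atTop)
    (F := fun k s => ∑ i ∈ s, (ρ k).real (A i)) ?_ (Eventually.of_forall hk)
    (hlim (MeasurableSet.iUnion hA))
  rw [Metric.tendstoUniformlyOnFilter_iff]
  intro r hr
  refine ((he.eventually (gt_mem_nhds hr)).prod_mk (Eventually.of_forall fun _ => trivial)).mono ?_
  rintro ⟨k, s⟩ ⟨hkr, -⟩
  rw [dist_comm, hfin, hadd]
  exact (h k _ (hunion s)).trans_lt hkr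

lemma exists_measure_of_uniform_limit {ρ : ℕ → Measure X} [∀ k, IsProbabilityMeasure (ρ k)]
    {L : Set X → ℝ} {e : ℕ → ℝ} (he : Tendsto e atTop (𝓝 0))
    (h : ∀ k A, MeasurableSet A → |(ρ k).real A - L A| ≤ e k) :
    ∃ π : Measure X, IsProbabilityMeasure π ∧ ∀ A, MeasurableSet A → π.real A = L A := by
  have hlim {A : Set X} (hA : MeasurableSet A) : Tendsto (fun k => (ρ k).real A) atTop (𝓝 (L A)) :=
    tendsto_iff_dist_tendsto_zero.2 (squeeze_zero (fun _ => dist_nonneg) (fun k => h k A hA) he)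
  have hnonneg {A : Set X} (hA : MeasurableSet A) : 0 ≤ L A :=
    ge_of_tendsto' (hlim hA) fun k => measureReal_nonneg
  have hempty : L ∅ = 0 := tendsto_nhds_unique (hlim .empty) (by simp)
  have huniv : L Set.univ = 1 := tendsto_nhds_unique (hlim .univ) (by simp)
  let π : Measure X := Measure.ofMeasurable (fun A _ => ENNReal.ofReal (L A)) (by simp [hempty])
    (fun A hA hd => by
      have hsum := hasSum_of_uniform_limit he h hA hd
      rw [← hsum.tsum_eq, ENNReal.ofReal_tsum_of_nonneg (fun i => hnonneg (hA i)) hsum.summable])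
  have hπ {A : Set X} (hA : MeasurableSet A) : π A = ENNReal.ofReal (L A) :=
    Measure.ofMeasurable_apply A hA
  refine ⟨π, ⟨by rw [hπ .univ, huniv, ENNReal.ofReal_one]⟩, fun A hA => ?_⟩
  rw [measureReal_def, hπ hA, ENNReal.toReal_ofReal (hnonneg hA)]

lemma exists_measure_of_geometric {ρ : ℕ → Measure X} [∀ k, IsProbabilityMeasure (ρ k)]
    {a D : ℝ} (ha0 : 0 ≤ a) (ha1 : a < 1)
    (h : ∀ k A, MeasurableSet A → |(ρ k).real A - (ρ (k + 1)).real A| ≤ D * a ^ k) :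
    ∃ π : Measure X, IsProbabilityMeasure π ∧
      ∀ k A, MeasurableSet A → |(ρ k).real A - π.real A| ≤ D * a ^ k / (1 - a) := by
  have hconv (A : Set X) :
      ∃ l, MeasurableSet A → Tendsto (fun k => (ρ k).real A) atTop (𝓝 l) := by
    by_cases hA : MeasurableSet A
    · obtain ⟨l, hl⟩ := cauchySeq_tendsto_of_complete
        (cauchySeq_of_le_geometric (f := fun k => (ρ k).real A) a D ha1 fun k => h k A hA)
      exact ⟨l, fun _ => hl⟩
    · exact ⟨0, fun hA' => absurd hA' hA⟩
  choose L hL using hconv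
  have hgeo (k : ℕ) (A : Set X) (hA : MeasurableSet A) :
      |(ρ k).real A - L A| ≤ D * a ^ k / (1 - a) :=
    dist_le_of_le_geometric_of_tendsto a D ha1 (fun k => h k A hA) (hL A hA) k
  have he : Tendsto (fun k => D * a ^ k / (1 - a)) atTop (𝓝 0) := by
    simpa using ((tendsto_pow_atTop_nhds_zero_of_lt_one ha0 ha1).const_mul D).div_const (1 - a)
  obtain ⟨π, hπ, hπL⟩ := exists_measure_of_uniform_limit he hgeo
  exact ⟨π, hπ, fun k A hA => by rw [hπL A hA]; exact hgeo k A hA⟩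

lemma abs_integral_sub_le_of_measureReal_le {ρ π : Measure X} [IsProbabilityMeasure ρ]
    [IsProbabilityMeasure π] {e : ℝ} (h : ∀ A, MeasurableSet A → |ρ.real A - π.real A| ≤ e)
    {φ : X → ℝ} (hφ : Measurable φ) (h0 : ∀ x, 0 ≤ φ x) (h1 : ∀ x, φ x ≤ 1) :
    |∫ x, φ x ∂ρ - ∫ x, φ x ∂π| ≤ e := by
  have hlayer (σ : Measure X) [IsProbabilityMeasure σ] :
      ∫ x, φ x ∂σ = ∫ t in Set.Ioc (0 : ℝ) 1, σ.real {x | t ≤ φ x} := by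
    refine Integrable.integral_eq_integral_Ioc_meas_le ?_ (ae_of_all _ h0) (ae_of_all _ h1)
    exact (integrable_const (1 : ℝ)).mono' hφ.aestronglyMeasurable
      (ae_of_all _ fun x => by simpa only [Real.norm_eq_abs, abs_of_nonneg (h0 x)] using h1 x)
  have hint (σ : Measure X) [IsProbabilityMeasure σ] :
      IntegrableOn (fun t : ℝ => σ.real {x | t ≤ φ x}) (Set.Ioc 0 1) := by
    have hanti : Antitone fun t : ℝ => σ.real {x | t ≤ φ x} :=
      fun s t hst => measureReal_mono fun x hx => hst.trans hx
    refine (integrable_const (1 : ℝ)).mono' hanti.measurable.aestronglyMeasurable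
      (ae_of_all _ fun t => ?_)
    rw [Real.norm_eq_abs, abs_of_nonneg measureReal_nonneg]
    exact measureReal_le_one
  rw [hlayer, hlayer, ← integral_sub (hint ρ) (hint π)]
  have := norm_setIntegral_le_of_norm_le_const (μ := volume) (s := Set.Ioc (0 : ℝ) 1) (C := e)
    (f := fun t => ρ.real {x | t ≤ φ x} - π.real {x | t ≤ φ x}) (by simp)
    (fun t _ => h _ (measurableSet_le measurable_const hφ))
  simpa using this

lemma measureReal_bind {ρ : Measure X} {κ : Kernel X X} [IsMarkovKernel κ] {A : Set X}
    (hA : MeasurableSet A) : (ρ.bind κ).real A = ∫ x, (κ x).real A ∂ρ := by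
  rw [measureReal_def, Measure.bind_apply hA κ.aemeasurable]
  exact (integral_toReal (κ.measurable_coe hA).aemeasurable
    (ae_of_all _ fun x => measure_lt_top _ _)).symm

end SetwiseLimit

section GeometricSeries

variable {V : X → ℝ}

lemma exists_sum_of_geometric {a D : ℝ} (ha0 : 0 ≤ a) (ha1 : a < 1)
    {u : ℕ → wBounded V} (hu : ∀ k x, |u k x| ≤ D * V x * a ^ k) :
    ∃ g : wBounded V, ∀ N x,
      |(∑ k ∈ Finset.range N, u k : wBounded V) x - g x| ≤ D / (1 - a) * V x * a ^ N := by
  have hsum (x : X) : Summable fun k => u k x :=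
    Summable.of_norm_bounded ((summable_geometric_of_lt_one ha0 ha1).mul_left _)
      (fun k => hu k x)
  have hG (N : ℕ) (x : X) :
      (∑ k ∈ Finset.range N, u k : wBounded V) x = ∑ k ∈ Finset.range N, u k x := by
    simp [Finset.sum_apply]
  have hlim (x : X) : Tendsto (fun N => (∑ k ∈ Finset.range N, u k : wBounded V) x) atTop
      (𝓝 (∑' k, u k x)) := by
    simp_rw [hG]
    exact (hsum x).hasSum.tendsto_sum_nat
  have hdist (N : ℕ) (x : X) : |(∑ k ∈ Finset.range N, u k : wBounded V) x - ∑' k, u k x|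
      ≤ D / (1 - a) * V x * a ^ N := by
    refine (dist_le_of_le_geometric_of_tendsto a (D * V x) ha1 (fun k => ?_) (hlim x)
      N).trans_eq (by ring)
    rw [dist_comm, Real.dist_eq, hG, hG, Finset.sum_range_succ, add_sub_cancel_left]
    exact hu k x
  refine ⟨⟨fun x => ∑' k, u k x, ?_, D / (1 - a), fun x => ?_⟩, hdist⟩
  · exact measurable_of_tendsto_metrizable
      (fun N => wBounded_measurable (∑ k ∈ Finset.range N, u k)) (tendsto_pi_nhds.2 hlim)
  · simpa using hdist 0 x

end GeometricSeries

section Harris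

lemma invariant_pow {κ : Kernel X X} {π : Measure X} (h : Kernel.Invariant κ π) (n : ℕ) :
    Kernel.Invariant (κ ^ n) π := by
  induction n with
  | zero => rw [pow_zero]; exact Measure.id_comp
  | succ n ih => rw [pow_succ]; exact ih.comp h

variable {V : X → ℝ} {a β M : ℝ}

lemma HasOscBound.abs_sub_integral_le {φ : wBounded V} (hφ : HasOscBound V β M φ) {ρ : Measure X}
    [IsProbabilityMeasure ρ] (hρ : Integrable V ρ) (x : X) :
    |φ x - ∫ y, φ y ∂ρ| ≤ M * (2 + β * (V x + ∫ y, V y ∂ρ)) := by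
  have hV : Integrable (fun y => V x + V y) ρ := (integrable_const _).add hρ
  have hbound : Integrable (fun y => M * (2 + β * (V x + V y))) ρ :=
    ((integrable_const _).add (hV.const_mul _)).const_mul M
  have hval : ∫ y, M * (2 + β * (V x + V y)) ∂ρ = M * (2 + β * (V x + ∫ y, V y ∂ρ)) := by
    rw [integral_const_mul, integral_add (integrable_const _) (hV.const_mul _),
      integral_const_mul, integral_add (integrable_const _) hρ]
    simp
  have hdiff : φ x - ∫ y, φ y ∂ρ = ∫ y, (φ x - φ y) ∂ρ := by
    rw [integral_sub (integrable_const _) (wBounded_integrable _ hρ)]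
    simp
  rw [hdiff, ← hval, ← Real.norm_eq_abs]
  exact norm_integral_le_of_norm_le hbound (ae_of_all _ (hφ x))

namespace AffineDrift

variable {κ : Kernel X X} {lam C : ℝ} (H : AffineDrift κ V lam C)
include H

lemma op_eq_sub_of_geometric (ha0 : 0 ≤ a) (ha1 : a < 1) {u : ℕ → wBounded V} {g : wBounded V}
    {E : ℝ} (hu : ∀ k, H.op (u k) = u (k + 1))
    (hg : ∀ N x, |(∑ k ∈ Finset.range N, u k : wBounded V) x - g x| ≤ E * V x * a ^ N) :
    H.op g = g - u 0 := by
  set G : ℕ → wBounded V := fun N => ∑ k ∈ Finset.range N, u k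
  have hG (N : ℕ) : H.op (G N) = G (N + 1) - u 0 := by
    simp only [G, map_sum, hu, Finset.sum_range_succ' u, add_sub_cancel_right]
  have hop (N : ℕ) (x : X) : |H.op (G N - g) x| ≤ E * a ^ N * H.op H.isWeight.self x := by
    have := H.abs_op_le (φ := G N - g) (ψ := (E * a ^ N) • H.isWeight.self)
      (fun y => (hg N y).trans_eq (mul_right_comm _ _ _)) x
    rwa [map_smul] at this
  ext x
  have hbound (N : ℕ) : |H.op g x - (g x - u 0 x)|
      ≤ E * a ^ N * H.op H.isWeight.self x + E * V x * a ^ (N + 1) := by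
    have hsplit : H.op g x - (g x - u 0 x) = (G (N + 1) x - g x) - H.op (G N - g) x := by
      rw [map_sub, hG]
      simp only [Submodule.coe_sub, Pi.sub_apply]
      ring
    rw [hsplit]
    exact (abs_sub _ _).trans ((add_le_add (hg (N + 1) x) (hop N x)).trans_eq (add_comm _ _))
  have hpow := tendsto_pow_atTop_nhds_zero_of_lt_one ha0 ha1
  have hzero : Tendsto (fun N : ℕ => E * a ^ N * H.op H.isWeight.self x + E * V x * a ^ (N + 1))
      atTop (𝓝 0) := by
    simpa using ((hpow.const_mul E).mul_const (H.op H.isWeight.self x)).add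
      (((tendsto_add_atTop_iff_nat 1).2 hpow).const_mul (E * V x))
  exact sub_eq_zero.1 (abs_nonpos_iff.1 (ge_of_tendsto' hzero hbound))

variable (hlam : lam < 1)
include hlam


lemma lintegral_min_le_of_invariant {π : Measure X} [IsProbabilityMeasure π]
    (hπ : Kernel.Invariant κ π) (N : ℕ) :
    ∫⁻ x, min (ENNReal.ofReal (V x)) N ∂π ≤ ENNReal.ofReal (C / (1 - lam)) := by
  have hV := H.isWeight.measurable
  have hle (j : ℕ) : ∫⁻ x, min (ENNReal.ofReal (V x)) N ∂π
      ≤ ∫⁻ x, min (ENNReal.ofReal (lam ^ j * V x + C / (1 - lam))) N ∂π := by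
    have := (H.pow hlam j).isMarkovKernel
    nth_rw 1 [← (invariant_pow hπ j).def]
    rw [Measure.lintegral_bind (κ ^ j).aemeasurable
      (hV.ennreal_ofReal.min measurable_const).aemeasurable]
    refine lintegral_mono fun x => le_min ?_ ?_
    · exact (lintegral_mono fun y => min_le_left _ _).trans ((H.pow hlam j).lintegral_le x)
    · exact (lintegral_mono fun y => min_le_right _ _).trans (by simp)
  have hlim : Tendsto (fun j : ℕ => ∫⁻ x, min (ENNReal.ofReal (lam ^ j * V x + C / (1 - lam))) N ∂π)
      atTop (𝓝 (∫⁻ _, min (ENNReal.ofReal (C / (1 - lam))) N ∂π)) := by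
    refine tendsto_lintegral_of_dominated_convergence (fun _ => (N : ℝ≥0∞)) (fun j => ?_)
      (fun j => ae_of_all _ fun x => min_le_right _ _) (by simp) (ae_of_all _ fun x => ?_)
    · exact ((hV.const_mul _).add_const _).ennreal_ofReal.min measurable_const
    · refine Tendsto.min (ENNReal.tendsto_ofReal ?_) tendsto_const_nhds
      simpa using ((tendsto_pow_atTop_nhds_zero_of_lt_one H.lam_nonneg
        hlam).mul_const (V x)).add_const (C / (1 - lam))
  refine (ge_of_tendsto' hlim hle).trans ?_
  rw [lintegral_const, measure_univ, mul_one]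
  exact min_le_left _ _

lemma lintegral_le_of_invariant {π : Measure X} [IsProbabilityMeasure π]
    (hπ : Kernel.Invariant κ π) :
    ∫⁻ x, ENNReal.ofReal (V x) ∂π ≤ ENNReal.ofReal (C / (1 - lam)) := by
  have hsup (x : X) : ENNReal.ofReal (V x) = ⨆ N : ℕ, min (ENNReal.ofReal (V x)) N := by
    rw [← inf_iSup_eq, ENNReal.iSup_natCast, inf_top_eq]
  rw [lintegral_congr hsup, lintegral_iSup
    (fun N => H.isWeight.measurable.ennreal_ofReal.min measurable_const)
    (fun M N hMN x => min_le_min_left _ (by exact_mod_cast hMN))]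
  exact iSup_le (H.lintegral_min_le_of_invariant hlam hπ)

lemma integrable_of_invariant {π : Measure X} [IsProbabilityMeasure π]
    (hπ : Kernel.Invariant κ π) : Integrable V π :=
  H.isWeight.integrable_iff_lintegral_lt_top.2
    ((H.lintegral_le_of_invariant hlam hπ).trans_lt ENNReal.ofReal_lt_top)

lemma integral_le_of_invariant {π : Measure X} [IsProbabilityMeasure π]
    (hπ : Kernel.Invariant κ π) : ∫ x, V x ∂π ≤ C / (1 - lam) :=
  H.isWeight.integral_le_of_lintegral_le (div_nonneg H.const_nonneg (by linarith))
    (H.lintegral_le_of_invariant hlam hπ)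

variable (hT : ContractsOsc V H.op a β)
include hT

lemma exists_abs_kernel_pow_sub_le (x : X) : ∃ D, ∀ k A, MeasurableSet A →
    |((κ ^ k) x).real A - ((κ ^ (k + 1)) x).real A| ≤ D * a ^ k := by
  have := H.isMarkovKernel
  refine ⟨2 + β * (V x + ∫ y, V y ∂(κ x)), fun k A hA => ?_⟩
  have hpow (k : ℕ) : ((κ ^ k) x).real A = (H.op ^ k) (H.isWeight.indicator hA) x := by
    rw [H.op_pow_apply hlam, H.isWeight.integral_indicator]
  have hosc := hT.hasOscBound_pow (H.isWeight.hasOscBound_indicator hT.pos.le hA) k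
  rw [hpow, hpow, pow_succ' H.op]
  exact (hosc.abs_sub_integral_le (H.integrable_kernel x) x).trans_eq (by ring)

lemma exists_tendsto_kernel_pow (x : X) : ∃ (π : Measure X) (e : ℕ → ℝ), IsProbabilityMeasure π ∧
    Tendsto e atTop (𝓝 0) ∧ ∀ k A, MeasurableSet A → |((κ ^ k) x).real A - π.real A| ≤ e k := by
  have := H.isMarkovKernel
  have hprob (k : ℕ) : IsProbabilityMeasure ((κ ^ k) x) :=
    (isMarkovKernel_pow κ k).isProbabilityMeasure x
  obtain ⟨D, hD⟩ := H.exists_abs_kernel_pow_sub_le hlam hT x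
  obtain ⟨π, hπ, hdist⟩ := exists_measure_of_geometric (ρ := fun k => (κ ^ k) x) hT.nonneg
    hT.lt_one hD
  refine ⟨π, fun k => D * a ^ k / (1 - a), hπ, ?_, hdist⟩
  simpa using ((tendsto_pow_atTop_nhds_zero_of_lt_one hT.nonneg hT.lt_one).const_mul
    D).div_const (1 - a)

lemma exists_stationary [Nonempty X] : ∃ π : Measure X, IsStationary κ π := by
  obtain ⟨x⟩ := ‹Nonempty X›
  have := H.isMarkovKernel
  have hprob (k : ℕ) : IsProbabilityMeasure ((κ ^ k) x) :=
    (isMarkovKernel_pow κ k).isProbabilityMeasure x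
  obtain ⟨π, e, hπ, he, hdist⟩ := H.exists_tendsto_kernel_pow hlam hT x
  refine ⟨π, hπ, Measure.ext fun A hA => (measureReal_eq_measureReal_iff
    (measure_ne_top _ _) (measure_ne_top _ _)).1 ?_⟩
  have hstep : Tendsto (fun k => ((κ ^ (k + 1)) x).real A) atTop (𝓝 (π.real A)) :=
    (tendsto_add_atTop_iff_nat (f := fun k => ((κ ^ k) x).real A) 1).2
      (tendsto_iff_dist_tendsto_zero.2
        (squeeze_zero (fun _ => dist_nonneg) (fun k => hdist k A hA) he))
  have hbind : Tendsto (fun k => ((κ ^ (k + 1)) x).real A) atTop (𝓝 ((π.bind κ).real A)) := by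
    refine tendsto_iff_dist_tendsto_zero.2
      (squeeze_zero (fun _ => dist_nonneg) (fun k => ?_) he)
    rw [kernel_pow_succ_apply, measureReal_bind hA, measureReal_bind hA]
    exact abs_integral_sub_le_of_measureReal_le (hdist k) (κ.measurable_coe hA).ennreal_toReal
      (fun x => measureReal_nonneg) fun x => measureReal_le_one
  exact tendsto_nhds_unique hbind hstep

lemma exists_geometric_bound {π : Measure X} [IsProbabilityMeasure π]
    (hπ : Kernel.Invariant κ π) (φ : wBounded V) :
    ∃ D, ∀ k x, |(H.op ^ k) φ x - ∫ y, φ y ∂π| ≤ D * V x * a ^ k := by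
  have := H.isMarkovKernel
  have hV := H.integrable_of_invariant hlam hπ
  have hinv (k : ℕ) : ∫ y, (H.op ^ k) φ y ∂π = ∫ y, φ y ∂π := by
    induction k with
    | zero => rfl
    | succ k ih =>
      rw [pow_succ', Module.End.mul_apply, (H.invariant_iff_integral_op hV).1 hπ, ih]
  obtain ⟨M, hM⟩ := H.isWeight.exists_hasOscBound hT.pos φ
  have hI : 0 ≤ ∫ y, V y ∂π := integral_nonneg fun y => (H.isWeight.pos y).le
  refine ⟨M * (2 + β * (1 + ∫ y, V y ∂π)), fun k x => ?_⟩
  have hMk : 0 ≤ a ^ k * M :=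
    mul_nonneg (pow_nonneg hT.nonneg k) (hM.nonneg H.isWeight hT.pos.le x)
  have hVx : 2 + β * (V x + ∫ y, V y ∂π) ≤ (2 + β * (1 + ∫ y, V y ∂π)) * V x := by
    nlinarith [mul_nonneg (mul_nonneg hT.pos.le hI) (sub_nonneg.2 (H.isWeight.one_le x)),
      H.isWeight.one_le x]
  rw [← hinv k]
  calc _ ≤ a ^ k * M * (2 + β * (V x + ∫ y, V y ∂π)) :=
        (hT.hasOscBound_pow hM k).abs_sub_integral_le hV x
    _ ≤ a ^ k * M * ((2 + β * (1 + ∫ y, V y ∂π)) * V x) := mul_le_mul_of_nonneg_left hVx hMk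
    _ = _ := by ring

lemma eq_of_invariant {π σ : Measure X} [IsProbabilityMeasure π] [IsProbabilityMeasure σ]
    (hπ : Kernel.Invariant κ π) (hσ : Kernel.Invariant κ σ) : σ = π := by
  obtain ⟨x⟩ : Nonempty X := nonempty_of_isProbabilityMeasure π
  have hlim {ρ : Measure X} [IsProbabilityMeasure ρ] (hρ : Kernel.Invariant κ ρ) (φ : wBounded V) :
      Tendsto (fun k => (H.op ^ k) φ x) atTop (𝓝 (∫ y, φ y ∂ρ)) := by
    obtain ⟨D, hD⟩ := H.exists_geometric_bound hlam hT hρ φ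
    refine tendsto_iff_dist_tendsto_zero.2 (squeeze_zero (fun _ => dist_nonneg)
      (fun k => hD k x) ?_)
    simpa using (tendsto_pow_atTop_nhds_zero_of_lt_one hT.nonneg hT.lt_one).const_mul (D * V x)
  exact H.isWeight.measure_eq_of_integral_eq fun φ => tendsto_nhds_unique (hlim hσ φ) (hlim hπ φ)

lemma exists_sub_op_eq {π : Measure X} [IsProbabilityMeasure π] (hπ : Kernel.Invariant κ π)
    (φ : wBounded V) :
    ∃ g : wBounded V, g - H.op g = φ - (∫ y, φ y ∂π) • H.isWeight.one := by
  obtain ⟨D, hD⟩ := H.exists_geometric_bound hlam hT hπ φ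
  let u (k : ℕ) : wBounded V := (H.op ^ k) φ - (∫ y, φ y ∂π) • H.isWeight.one
  have hopu (k : ℕ) : H.op (u k) = u (k + 1) := by simp [u, H.op_one, pow_succ']
  obtain ⟨g, hg⟩ := exists_sum_of_geometric hT.nonneg hT.lt_one (u := u)
    fun k x => by simpa [u] using hD k x
  refine ⟨g, ?_⟩
  rw [H.op_eq_sub_of_geometric hT.nonneg hT.lt_one hopu hg, sub_sub_cancel]
  simp [u]

end AffineDrift

end Harris

section CesaroKernel

lemma kernel_pow_add_apply (κ : Kernel X X) (m j : ℕ) (x : X) :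
    (κ ^ (m + j)) x = ((κ ^ j) x).bind (κ ^ m) := by
  rw [pow_add]
  exact Kernel.comp_apply (κ ^ m) (κ ^ j) x

/-- The average of the kernels `κ ^ m, …, κ ^ (m + n - 1)`. -/
def cesaroKernel (κ : Kernel X X) (m n : ℕ) : Kernel X X where
  toFun x := (n : ℝ≥0∞)⁻¹ • ∑ j ∈ Finset.range n, (κ ^ (m + j)) x
  measurable' := Measure.measurable_of_measurable_coe _ fun A hA => by
    simp only [Measure.smul_apply, Measure.finsetSum_apply]
    exact (Finset.measurable_fun_sum _ fun j _ => (κ ^ (m + j)).measurable_coe hA).const_mul _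

lemma cesaroKernel_apply (κ : Kernel X X) (m n : ℕ) (x : X) :
    cesaroKernel κ m n x = (n : ℝ≥0∞)⁻¹ • ∑ j ∈ Finset.range n, (κ ^ (m + j)) x := rfl

lemma lintegral_cesaroKernel (κ : Kernel X X) (m n : ℕ) (x : X) (F : X → ℝ≥0∞) :
    ∫⁻ y, F y ∂(cesaroKernel κ m n x)
      = (n : ℝ≥0∞)⁻¹ * ∑ j ∈ Finset.range n, ∫⁻ y, F y ∂((κ ^ (m + j)) x) := by
  rw [cesaroKernel_apply, lintegral_smul_measure, lintegral_finsetSum_measure, smul_eq_mul]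

lemma ennreal_average_const {n : ℕ} (hn : n ≠ 0) (c : ℝ≥0∞) :
    (n : ℝ≥0∞)⁻¹ * ∑ _j ∈ Finset.range n, c = c := by
  rw [Finset.sum_const, Finset.card_range, nsmul_eq_mul, ← mul_assoc,
    ENNReal.inv_mul_cancel (by exact_mod_cast hn) (ENNReal.natCast_ne_top n), one_mul]

lemma isMarkovKernel_cesaroKernel (κ : Kernel X X) [IsMarkovKernel κ] (m : ℕ) {n : ℕ}
    (hn : n ≠ 0) : IsMarkovKernel (cesaroKernel κ m n) := by
  refine ⟨fun x => ⟨?_⟩⟩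
  have (j : ℕ) : ∫⁻ _, 1 ∂((κ ^ (m + j)) x) = 1 := by
    have := isMarkovKernel_pow κ (m + j)
    simp
  rw [← lintegral_one, lintegral_cesaroKernel, Finset.sum_congr rfl fun j _ => this j,
    ennreal_average_const hn]

namespace AffineDrift

variable {κ : Kernel X X} {V : X → ℝ} {lam C : ℝ} (H : AffineDrift κ V lam C) (hlam : lam < 1)
include H hlam

lemma cesaroKernel {m n : ℕ} (hm : m ≠ 0) (hn : n ≠ 0) :
    AffineDrift (cesaroKernel κ m n) V lam (C / (1 - lam)) where
  isMarkovKernel := have := H.isMarkovKernel; isMarkovKernel_cesaroKernel κ m hn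
  isWeight := H.isWeight
  lam_nonneg := H.lam_nonneg
  const_nonneg := div_nonneg H.const_nonneg (by linarith)
  lintegral_le x := by
    rw [lintegral_cesaroKernel,
      ← ennreal_average_const hn (ENNReal.ofReal (lam * V x + C / (1 - lam)))]
    gcongr with j
    refine ((H.pow hlam (m + j)).lintegral_le x).trans (ENNReal.ofReal_le_ofReal ?_)
    gcongr
    · exact (H.isWeight.pos x).le
    · exact pow_le_of_le_one H.lam_nonneg hlam.le (by omega)

variable {m n : ℕ} (hm : m ≠ 0) (hn : n ≠ 0)

lemma op_cesaroKernel : (H.cesaroKernel hlam hm hn).op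
    = (n : ℝ)⁻¹ • ∑ j ∈ Finset.range n, H.op ^ (m + j) := by
  ext φ x
  have hint (j : ℕ) : Integrable φ ((κ ^ (m + j)) x) :=
    wBounded_integrable φ ((H.pow hlam (m + j)).integrable_kernel x)
  rw [op_apply, cesaroKernel_apply, integral_smul_measure,
    integral_finsetSum_measure fun j _ => hint j]
  simp [LinearMap.sum_apply, Finset.sum_apply, H.op_pow_apply hlam]

lemma commute_op_cesaroKernel : Commute H.op (H.cesaroKernel hlam hm hn).op := by
  rw [H.op_cesaroKernel hlam hm hn]
  exact (Commute.sum_right _ _ _ fun j _ => (Commute.refl H.op).pow_right (m + j)).smul_right _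

/-- By the geometric sum formula, `1 - κ` divides `1 - κ ^ (m + j)` for every `j`. -/
lemma exists_one_sub_op_cesaroKernel :
    ∃ S : Module.End ℝ (wBounded V), 1 - (H.cesaroKernel hlam hm hn).op = (1 - H.op) * S := by
  refine ⟨(n : ℝ)⁻¹ • ∑ j ∈ Finset.range n, ∑ i ∈ Finset.range (m + j), H.op ^ i, ?_⟩
  have hn' : (n : ℝ) ≠ 0 := by exact_mod_cast hn
  rw [mul_smul_comm, Finset.mul_sum,
    Finset.sum_congr rfl fun j _ => mul_neg_geom_sum H.op (m + j),
    Finset.sum_sub_distrib (fun _ => 1) (fun j => H.op ^ (m + j)), smul_sub,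
    H.op_cesaroKernel hlam hm hn, Finset.sum_const, Finset.card_range, ← Nat.cast_smul_eq_nsmul ℝ,
    smul_smul, inv_mul_cancel₀ hn', one_smul]

include hm hn in
lemma invariant_cesaroKernel {π : Measure X} [IsProbabilityMeasure π]
    (hπ : Kernel.Invariant κ π) : Kernel.Invariant (LRGradient.cesaroKernel κ m n) π := by
  have hV := H.integrable_of_invariant hlam hπ
  obtain ⟨S, hS⟩ := H.exists_one_sub_op_cesaroKernel hlam hm hn
  have hint (ψ : wBounded V) : Integrable ψ π := wBounded_integrable ψ hV
  refine ((H.cesaroKernel hlam hm hn).invariant_iff_integral_op hV).2 fun φ => ?_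
  have hφ : (H.cesaroKernel hlam hm hn).op φ = φ - (S φ - H.op (S φ)) := by
    have := LinearMap.congr_fun hS φ
    simp only [LinearMap.sub_apply, Module.End.mul_apply, Module.End.one_apply] at this
    rw [← this, sub_sub_cancel]
  calc ∫ x, (H.cesaroKernel hlam hm hn).op φ x ∂π
      = ∫ x, φ x ∂π - (∫ x, S φ x ∂π - ∫ x, H.op (S φ) x ∂π) := by
        rw [hφ, ← integral_sub (hint (S φ)) (hint _)]
        exact integral_sub (hint φ) (hint (S φ - H.op (S φ)))
    _ = ∫ x, φ x ∂π := by
        rw [(H.invariant_iff_integral_op hV).1 hπ, sub_self, sub_zero]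

end AffineDrift

end CesaroKernel

section DriftMinorization

/-- A Markov kernel with a geometric drift of `V` towards the small set `K`. -/
structure DriftMinorization (κ : Kernel X X) (K : Set X) (δ : ℝ) (m : ℕ) (ν : Measure X)
    (V : X → ℝ) (lam b : ℝ) : Prop where
  isMarkovKernel : IsMarkovKernel κ
  isWeight : IsWeight V
  measurableSet_small : MeasurableSet K
  delta_pos : 0 < δ
  m_ne_zero : m ≠ 0
  isProbabilityMeasure : IsProbabilityMeasure ν
  smul_le_pow : ∀ x ∈ K, ENNReal.ofReal δ • ν ≤ (κ ^ m) x
  lam_nonneg : 0 ≤ lam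
  lam_lt_one : lam < 1
  b_pos : 0 < b
  lintegral_le : ∀ x,
    ∫⁻ y, ENNReal.ofReal (V y) ∂(κ x) ≤ ENNReal.ofReal (lam * V x + K.indicator (fun _ => b) x)

namespace DriftMinorization

variable {κ : Kernel X X} {K : Set X} {δ : ℝ} {m : ℕ} {ν : Measure X} {V : X → ℝ} {lam b : ℝ}
variable (H : DriftMinorization κ K δ m ν V lam b)
include H

lemma affineDrift : AffineDrift κ V lam b where
  isMarkovKernel := H.isMarkovKernel
  isWeight := H.isWeight
  lam_nonneg := H.lam_nonneg
  const_nonneg := H.b_pos.le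
  lintegral_le x := by
    refine (H.lintegral_le x).trans (ENNReal.ofReal_le_ofReal ?_)
    gcongr
    exact Set.indicator_le_self' (fun _ _ => H.b_pos.le) x

/-- Iterating the drift counts the visits to the small set. -/
lemma lintegral_pow_le (n : ℕ) (x : X) :
    ∫⁻ y, ENNReal.ofReal (V y) ∂((κ ^ n) x) ≤ ENNReal.ofReal (lam ^ n * V x)
      + ENNReal.ofReal b * ∑ j ∈ Finset.range n, (κ ^ j) x K := by
  have := H.isMarkovKernel
  have hV := H.isWeight.measurable.ennreal_ofReal
  have hK : Measurable (K.indicator (1 : X → ℝ≥0∞)) :=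
    measurable_one.indicator H.measurableSet_small
  have hdrift (z : X) : ∫⁻ y, ENNReal.ofReal (V y) ∂(κ z) ≤ ENNReal.ofReal lam
      * ENNReal.ofReal (V z) + ENNReal.ofReal b * K.indicator 1 z := by
    refine (H.lintegral_le z).trans ?_
    rw [← ENNReal.ofReal_mul H.lam_nonneg]
    by_cases hz : z ∈ K
    · simpa [hz] using ENNReal.ofReal_add_le
    · simp [hz]
  induction n with
  | zero =>
    rw [kernel_pow_zero_apply, lintegral_dirac' _ hV]
    simp
  | succ n ih =>
    rw [kernel_pow_succ_apply, Measure.lintegral_bind κ.aemeasurable hV.aemeasurable]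
    calc ∫⁻ z, ∫⁻ y, ENNReal.ofReal (V y) ∂(κ z) ∂((κ ^ n) x)
        ≤ ∫⁻ z, (ENNReal.ofReal lam * ENNReal.ofReal (V z) + ENNReal.ofReal b * K.indicator 1 z)
            ∂((κ ^ n) x) := lintegral_mono hdrift
      _ = ENNReal.ofReal lam * ∫⁻ z, ENNReal.ofReal (V z) ∂((κ ^ n) x)
            + ENNReal.ofReal b * (κ ^ n) x K := by
          rw [lintegral_add_left (hV.const_mul _), lintegral_const_mul _ hV,
            lintegral_const_mul _ hK, lintegral_indicator_one H.measurableSet_small]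
      _ ≤ ENNReal.ofReal lam * ENNReal.ofReal (lam ^ n * V x)
            + 1 * (ENNReal.ofReal b * ∑ j ∈ Finset.range n, (κ ^ j) x K)
            + ENNReal.ofReal b * (κ ^ n) x K := by
          have hle : ENNReal.ofReal lam ≤ 1 := ENNReal.ofReal_le_one.2 H.lam_lt_one.le
          refine add_le_add_left ((mul_le_mul_right ih _).trans ?_) _
          rw [mul_add]
          gcongr
      _ = _ := by
          rw [← ENNReal.ofReal_mul H.lam_nonneg, ← mul_assoc, ← pow_succ', one_mul, add_assoc,
            ← mul_add, ← Finset.sum_range_succ]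

lemma le_sum_pow_small {R : ℝ} {n : ℕ} (hn : lam ^ n * R ≤ 1 / 2) {x : X} (hx : V x ≤ R) :
    ENNReal.ofReal (1 / (2 * b)) ≤ ∑ j ∈ Finset.range n, (κ ^ j) x K := by
  have := H.isMarkovKernel
  have := isMarkovKernel_pow κ n
  have hone : 1 ≤ ∫⁻ y, ENNReal.ofReal (V y) ∂((κ ^ n) x) := by
    calc (1 : ℝ≥0∞) = ∫⁻ _, 1 ∂((κ ^ n) x) := by simp
      _ ≤ _ := lintegral_mono fun y => ENNReal.one_le_ofReal.2 (H.isWeight.one_le y)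
  have hhalf : ENNReal.ofReal (lam ^ n * V x) ≤ ENNReal.ofReal (1 / 2) :=
    ENNReal.ofReal_le_ofReal
      ((mul_le_mul_of_nonneg_left hx (pow_nonneg H.lam_nonneg n)).trans hn)
  have hb : ENNReal.ofReal (1 / 2)
      ≤ ENNReal.ofReal b * ∑ j ∈ Finset.range n, (κ ^ j) x K := by
    have htotal := hone.trans ((H.lintegral_pow_le n x).trans (add_le_add_left hhalf _))
    have hsum : ENNReal.ofReal (1 / 2) + ENNReal.ofReal (1 / 2) = 1 := by
      rw [← ENNReal.ofReal_add (by norm_num) (by norm_num), add_halves, ENNReal.ofReal_one]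
    exact (ENNReal.add_le_add_iff_left ENNReal.ofReal_ne_top).1 (hsum.trans_le htotal)
  rw [show 1 / (2 * b) = 1 / 2 / b by rw [div_div], ENNReal.ofReal_div_of_pos H.b_pos]
  exact ENNReal.div_le_of_le_mul' hb

lemma smul_le_pow_add (j : ℕ) (x : X) :
    ((κ ^ j) x K * ENNReal.ofReal δ) • ν ≤ (κ ^ (m + j)) x := by
  refine Measure.le_iff.2 fun A hA => ?_
  rw [kernel_pow_add_apply, Measure.bind_apply hA (κ ^ m).aemeasurable]
  calc ((κ ^ j) x K * ENNReal.ofReal δ) * ν A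
      = ∫⁻ _ in K, ENNReal.ofReal δ * ν A ∂((κ ^ j) x) := by
        rw [setLIntegral_const, mul_comm _ ((κ ^ j) x K), mul_assoc]
    _ ≤ ∫⁻ z in K, (κ ^ m) z A ∂((κ ^ j) x) :=
        setLIntegral_mono' H.measurableSet_small fun z hz => H.smul_le_pow z hz A
    _ ≤ _ := setLIntegral_le_lintegral _ _

lemma smul_le_cesaroKernel {R : ℝ} {n : ℕ} (hn : lam ^ n * R ≤ 1 / 2) {x : X} (hx : V x ≤ R) :
    ((n : ℝ≥0∞)⁻¹ * (ENNReal.ofReal (1 / (2 * b)) * ENNReal.ofReal δ)) • ν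
      ≤ cesaroKernel κ m n x := by
  rw [cesaroKernel_apply, mul_smul]
  refine Measure.le_iff'.2 fun A => mul_le_mul_right (Measure.le_iff'.1 ?_ A) _
  calc (ENNReal.ofReal (1 / (2 * b)) * ENNReal.ofReal δ) • ν
      ≤ ((∑ j ∈ Finset.range n, (κ ^ j) x K) * ENNReal.ofReal δ) • ν := by
        gcongr
        exact H.le_sum_pow_small hn hx
    _ = ∑ j ∈ Finset.range n, ((κ ^ j) x K * ENNReal.ofReal δ) • ν := by
        rw [Finset.sum_mul, Finset.sum_smul]
    _ ≤ _ := Finset.sum_le_sum fun j _ => H.smul_le_pow_add j x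

/-- A power of `κ` need not contract, since `κ` may be periodic; averaging over consecutive powers
makes the minorization uniform on sublevel sets of `V`. -/
theorem exists_contractsOsc_cesaroKernel : ∃ (n : ℕ) (hn : n ≠ 0) (a β : ℝ),
    ContractsOsc V (H.affineDrift.cesaroKernel H.lam_lt_one H.m_ne_zero hn).op a β := by
  have := H.isProbabilityMeasure
  have hb := H.b_pos
  have hδ := H.delta_pos
  have hlam : 0 < 1 - lam := sub_pos.2 H.lam_lt_one
  set R := (4 * (b / (1 - lam)) + 1) / (1 - lam)
  have hR : 4 * (b / (1 - lam)) < (1 - lam) * R := by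
    rw [mul_div_cancel₀ _ hlam.ne']
    exact lt_add_one _
  obtain ⟨n, hn, hnR⟩ : ∃ n : ℕ, n ≠ 0 ∧ lam ^ n * R ≤ 1 / 2 := by
    have hlim : Tendsto (fun n : ℕ => lam ^ n * R) atTop (𝓝 0) := by
      simpa using (tendsto_pow_atTop_nhds_zero_of_lt_one H.lam_nonneg H.lam_lt_one).mul_const R
    exact ((eventually_ne_atTop 0).and (hlim.eventually_le_const (by norm_num))).exists
  have hn0 : (0 : ℝ) < n := by exact_mod_cast hn.bot_lt
  refine ⟨n, hn, AffineDrift.exists_contractsOsc (ν := ν) _ H.lam_lt_one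
    (η := (n : ℝ)⁻¹ * (1 / (2 * b) * δ)) (by positivity) hR fun x hx => ?_⟩
  rw [ENNReal.ofReal_mul (by positivity), ENNReal.ofReal_mul (by positivity),
    ENNReal.ofReal_inv_of_pos hn0, ENNReal.ofReal_natCast]
  exact H.smul_le_cesaroKernel hnR hx

theorem existsUnique_stationary [Nonempty X] : ∃! π : Measure X, IsStationary κ π := by
  have := H.isMarkovKernel
  have hlam := H.lam_lt_one
  have HA := H.affineDrift
  obtain ⟨n, hn, a, β, hT⟩ := H.exists_contractsOsc_cesaroKernel
  have HQ := HA.cesaroKernel hlam H.m_ne_zero hn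
  obtain ⟨π, hπ, hπQ⟩ := HQ.exists_stationary hlam hT
  have hV := HQ.integrable_of_invariant hlam hπQ
  have hbind : Kernel.Invariant (cesaroKernel κ m n) (π.bind κ) := by
    refine (HQ.invariant_iff_integral_op (HA.integrable_bind hV)).2 fun φ => ?_
    have hcomm : HA.op (HQ.op φ) = HQ.op (HA.op φ) :=
      LinearMap.congr_fun (HA.commute_op_cesaroKernel hlam H.m_ne_zero hn).eq φ
    rw [HA.integral_bind hV, HA.integral_bind hV, hcomm,
      (HQ.invariant_iff_integral_op hV).1 hπQ]
  refine ⟨π, ⟨hπ, HQ.eq_of_invariant hlam hT hπQ hbind⟩, fun σ hσ => ?_⟩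
  have := hσ.1
  exact HQ.eq_of_invariant hlam hT hπQ
    (HA.invariant_cesaroKernel hlam H.m_ne_zero hn hσ.2)

theorem exists_poisson {π : Measure X} [IsProbabilityMeasure π] (hπ : Kernel.Invariant κ π)
    {φ : X → ℝ} (hφ : φ ∈ wBounded V) :
    ∃ g ∈ wBounded V, ∀ x, g x - ∫ y, g y ∂(κ x) = φ x - ∫ y, φ y ∂π := by
  have hlam := H.lam_lt_one
  have HA := H.affineDrift
  obtain ⟨n, hn, a, β, hT⟩ := H.exists_contractsOsc_cesaroKernel
  obtain ⟨g, hg⟩ := (HA.cesaroKernel hlam H.m_ne_zero hn).exists_sub_op_eq hlam hT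
    (HA.invariant_cesaroKernel hlam H.m_ne_zero hn hπ) ⟨φ, hφ⟩
  obtain ⟨S, hS⟩ := HA.exists_one_sub_op_cesaroKernel hlam H.m_ne_zero hn
  have hSg : S g - HA.op (S g) = g - (HA.cesaroKernel hlam H.m_ne_zero hn).op g :=
    (LinearMap.congr_fun hS g).symm
  refine ⟨S g, (S g).2, fun x => ?_⟩
  simpa [AffineDrift.op_apply] using congrFun (congrArg Subtype.val (hSg.trans hg)) x

end DriftMinorization

end DriftMinorization

section SqrtWeight

variable {V : X → ℝ}

lemma IsWeight.sqrt (hV : IsWeight V) : IsWeight fun x => √(V x) where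
  measurable := hV.measurable.sqrt
  one_le x := Real.one_le_sqrt.2 (hV.one_le x)

lemma IsWeight.wBounded_sqrt_le (hV : IsWeight V) : wBounded (fun x => √(V x)) ≤ wBounded V := by
  intro φ hφ
  obtain ⟨M, hM0, hM⟩ := hV.sqrt.exists_abs_le ⟨φ, hφ⟩
  refine ⟨hφ.1, M, fun x => (hM x).trans (mul_le_mul_of_nonneg_left ?_ hM0)⟩
  exact Real.sqrt_le_iff.2 ⟨(hV.pos x).le, le_self_pow₀ (hV.one_le x) two_ne_zero⟩

lemma IsWeight.sq_mem_wBounded (hV : IsWeight V) {φ : X → ℝ} (hφ : φ ∈ wBounded fun x => √(V x)) :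
    (fun x => φ x ^ 2) ∈ wBounded V := by
  obtain ⟨M, hM⟩ := hφ.2
  refine ⟨hφ.1.pow_const 2, M ^ 2, fun x => ?_⟩
  calc |φ x ^ 2| = |φ x| ^ 2 := abs_pow _ _
    _ ≤ (M * √(V x)) ^ 2 := by gcongr; exact hM x
    _ = M ^ 2 * V x := by rw [mul_pow, Real.sq_sqrt (hV.pos x).le]

lemma IsWeight.integrable_sqrt (hV : IsWeight V) {ρ : Measure X} (hρ : Integrable V ρ) :
    Integrable (fun x => √(V x)) ρ :=
  wBounded_integrable ⟨_, hV.wBounded_sqrt_le hV.sqrt.self.2⟩ hρ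

lemma IsWeight.integral_sqrt_le (hV : IsWeight V) {ρ : Measure X} [IsProbabilityMeasure ρ]
    (hρ : Integrable V ρ) : ∫ x, √(V x) ∂ρ ≤ √(∫ x, V x ∂ρ) :=
  Real.strictConcaveOn_sqrt.concaveOn.le_map_integral Real.continuous_sqrt.continuousOn isClosed_Ici
    (ae_of_all _ fun x => (hV.pos x).le) hρ (hV.integrable_sqrt hρ)

lemma sqrt_add_le_sqrt_add_sqrt {a c : ℝ} (ha : 0 ≤ a) (hc : 0 ≤ c) : √(a + c) ≤ √a + √c := by
  refine Real.sqrt_le_iff.2 ⟨by positivity, ?_⟩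
  rw [add_sq, Real.sq_sqrt ha, Real.sq_sqrt hc]
  have := mul_nonneg (Real.sqrt_nonneg a) (Real.sqrt_nonneg c)
  linarith

lemma DriftMinorization.integral_le {κ : Kernel X X} {K : Set X} {δ : ℝ} {m : ℕ} {ν : Measure X}
    {lam b : ℝ} (H : DriftMinorization κ K δ m ν V lam b) (x : X) :
    ∫ y, V y ∂(κ x) ≤ lam * V x + K.indicator (fun _ => b) x :=
  H.isWeight.integral_le_of_lintegral_le
    (add_nonneg (mul_nonneg H.lam_nonneg (H.isWeight.pos x).le)
      (Set.indicator_nonneg (fun _ _ => H.b_pos.le) x)) (H.lintegral_le x)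

lemma DriftMinorization.sqrt {κ : Kernel X X} {K : Set X} {δ : ℝ} {m : ℕ} {ν : Measure X}
    {lam b : ℝ} (H : DriftMinorization κ K δ m ν V lam b) :
    DriftMinorization κ K δ m ν (fun x => √(V x)) (√lam) (√b) where
  isMarkovKernel := H.isMarkovKernel
  isWeight := H.isWeight.sqrt
  measurableSet_small := H.measurableSet_small
  delta_pos := H.delta_pos
  m_ne_zero := H.m_ne_zero
  isProbabilityMeasure := H.isProbabilityMeasure
  smul_le_pow := H.smul_le_pow
  lam_nonneg := Real.sqrt_nonneg lam
  lam_lt_one := by simpa [Real.sqrt_lt' one_pos] using H.lam_lt_one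
  b_pos := Real.sqrt_pos.2 H.b_pos
  lintegral_le x := by
    have := H.isMarkovKernel
    have hint := H.affineDrift.integrable_kernel x
    rw [← ofReal_integral_eq_lintegral_ofReal (H.isWeight.integrable_sqrt hint)
      (ae_of_all _ fun y => Real.sqrt_nonneg _)]
    refine ENNReal.ofReal_le_ofReal ?_
    calc ∫ y, √(V y) ∂(κ x) ≤ √(∫ y, V y ∂(κ x)) := H.isWeight.integral_sqrt_le hint
      _ ≤ √(lam * V x + K.indicator (fun _ => b) x) := Real.sqrt_le_sqrt (H.integral_le x)
      _ ≤ √(lam * V x) + √(K.indicator (fun _ => b) x) :=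
          sqrt_add_le_sqrt_add_sqrt (mul_nonneg H.lam_nonneg (H.isWeight.pos x).le)
            (Set.indicator_nonneg (fun _ _ => H.b_pos.le) x)
      _ = √lam * √(V x) + K.indicator (fun _ => √b) x := by
          rw [Real.sqrt_mul H.lam_nonneg]
          by_cases hx : x ∈ K <;> simp [hx]

end SqrtWeight

section OpNorm

variable {V : X → ℝ}

lemma le_wnorm_mul {Y : Type*} {w : Y → ℝ} (hw : ∀ x, 0 < w x) (F : Y → ℝ≥0∞) (x : Y) :
    F x ≤ wnorm w F * ENNReal.ofReal (w x) := by
  rw [← ENNReal.div_le_iff_le_mul (Or.inl (ENNReal.ofReal_pos.2 (hw x)).ne')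
    (Or.inl ENNReal.ofReal_ne_top)]
  exact le_iSup (fun x => F x / ENNReal.ofReal (w x)) x

lemma abs_le_wnorm_mul {Y : Type*} {w u : Y → ℝ} (hw : ∀ x, 0 < w x)
    (hu : wnorm w (fun x => ‖u x‖ₑ) ≠ ∞) (x : Y) :
    |u x| ≤ (wnorm w fun x => ‖u x‖ₑ).toReal * w x := by
  have h := ENNReal.toReal_mono (ENNReal.mul_ne_top hu ENNReal.ofReal_ne_top)
    (le_wnorm_mul hw (fun x => ‖u x‖ₑ) x)
  rwa [toReal_enorm, ENNReal.toReal_mul, ENNReal.toReal_ofReal (hw x).le] at h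

lemma wnorm_le_ofReal {Y : Type*} {w u : Y → ℝ} {M : ℝ} (hM0 : 0 ≤ M)
    (hM : ∀ x, |u x| ≤ M * w x) : wnorm w (fun x => ‖u x‖ₑ) ≤ ENNReal.ofReal M := by
  refine iSup_le fun x => ENNReal.div_le_of_le_mul ?_
  rw [← ENNReal.ofReal_mul hM0]
  exact (Real.enorm_eq_ofReal_abs (u x)).trans_le (ENNReal.ofReal_le_ofReal (hM x))

lemma wnorm_const_mul {Y : Type*} (w : Y → ℝ) (c : ℝ) (u : Y → ℝ) :
    wnorm w (fun x => ‖c * u x‖ₑ) = ‖c‖ₑ * wnorm w fun x => ‖u x‖ₑ := by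
  simp only [wnorm, ENNReal.mul_iSup, enorm_mul, mul_div_assoc]

lemma wnorm_apply_le_opNorm_mul (hV : ∀ x, 0 < V x) {T : (X → ℝ) → X → ℝ}
    (hT : ∀ (c : ℝ) u x, T (fun y => c * u y) x = c * T u x) {u : X → ℝ} (hu : Measurable u)
    (hfin : wnorm V (fun x => ‖u x‖ₑ) ≠ ∞) :
    wnorm V (fun x => ‖T u x‖ₑ) ≤ opNorm V T * wnorm V fun x => ‖u x‖ₑ := by
  set s := wnorm V fun x => ‖u x‖ₑ with hs
  rcases eq_or_ne s 0 with h0 | h0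
  · have hu0 : u = fun y => 0 * u y := by
      funext y
      have h := le_wnorm_mul hV (fun x => ‖u x‖ₑ) y
      rw [← hs, h0, zero_mul, nonpos_iff_eq_zero, enorm_eq_zero] at h
      rw [h, mul_zero]
    have hTu : (fun x => ‖T u x‖ₑ) = fun _ => 0 := by
      funext x
      rw [hu0, hT, zero_mul, enorm_zero]
    rw [hTu]
    simp [wnorm]
  · have hnorm : ‖s.toReal⁻¹‖ₑ = s⁻¹ := by
      have hpos := ENNReal.toReal_pos h0 hfin
      rw [← ofReal_norm, Real.norm_of_nonneg (inv_nonneg.2 hpos.le),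
        ENNReal.ofReal_inv_of_pos hpos, ENNReal.ofReal_toReal hfin]
    have hunit : wnorm V (fun x => ‖s.toReal⁻¹ * u x‖ₑ) = 1 := by
      rw [wnorm_const_mul, hnorm, ENNReal.inv_mul_cancel h0 hfin]
    have h : wnorm V (fun x => ‖T (fun y => s.toReal⁻¹ * u y) x‖ₑ) ≤ opNorm V T :=
      le_iSup (fun v : {v : X → ℝ // Measurable v ∧ wnorm V (fun x => ‖v x‖ₑ) = 1} =>
        wnorm V (fun x => ‖T v.1 x‖ₑ)) ⟨_, hu.const_mul _, hunit⟩
    simp only [hT, wnorm_const_mul, hnorm] at h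
    rwa [← ENNReal.div_eq_inv_mul, ENNReal.div_le_iff h0 hfin] at h

lemma abs_apply_le_opNorm (hV : ∀ x, 0 < V x) {T : (X → ℝ) → X → ℝ}
    (hT : ∀ (c : ℝ) u x, T (fun y => c * u y) x = c * T u x) (hfin : opNorm V T ≠ ∞)
    {u : X → ℝ} (hu : Measurable u) {M : ℝ} (hM : ∀ x, |u x| ≤ M * V x) (x : X) :
    |T u x| ≤ M * (opNorm V T).toReal * V x := by
  have hM0 : 0 ≤ M := nonneg_of_mul_nonneg_left ((abs_nonneg _).trans (hM x)) (hV x)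
  have hle := wnorm_le_ofReal hM0 hM
  have hTu := wnorm_apply_le_opNorm_mul hV hT hu (hle.trans_lt ENNReal.ofReal_lt_top).ne
  have hbound : wnorm V (fun x => ‖T u x‖ₑ) ≤ opNorm V T * ENNReal.ofReal M := by
    grw [hTu, hle]
  have htop := ENNReal.mul_ne_top hfin (ENNReal.ofReal_ne_top (r := M))
  refine (abs_le_wnorm_mul hV (hbound.trans_lt htop.lt_top).ne x).trans ?_
  refine mul_le_mul_of_nonneg_right ((ENNReal.toReal_mono htop hbound).trans_eq ?_) (hV x).le
  rw [ENNReal.toReal_mul, ENNReal.toReal_ofReal hM0, mul_comm]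

end OpNorm

section Perturbation

/-- Testing the Poisson equation of `κ` against the invariant measure of another kernel `κ'`. -/
lemma AffineDrift.integral_sub_eq_of_poisson {κ κ' : Kernel X X} {V : X → ℝ} {lam C lam' C' : ℝ}
    (H : AffineDrift κ V lam C) (H' : AffineDrift κ' V lam' C') {π' : Measure X}
    [IsProbabilityMeasure π'] (hπ' : Kernel.Invariant κ' π') (hV : Integrable V π') {u g : X → ℝ}
    {c : ℝ} (hu : u ∈ wBounded V) (hg : g ∈ wBounded V)
    (hP : ∀ x, g x - ∫ y, g y ∂(κ x) = u x - c) :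
    ∫ x, u x ∂π' - c = ∫ x, ((∫ y, g y ∂(κ' x)) - ∫ y, g y ∂(κ x)) ∂π' := by
  have hint {v : X → ℝ} (hv : v ∈ wBounded V) : Integrable v π' := wBounded_integrable ⟨v, hv⟩ hV
  calc ∫ x, u x ∂π' - c = ∫ x, (u x - c) ∂π' := by
        rw [integral_sub (hint hu) (integrable_const _), integral_const, probReal_univ, one_smul]
    _ = ∫ x, (g x - ∫ y, g y ∂(κ x)) ∂π' := by simp_rw [hP]
    _ = ∫ x, g x ∂π' - ∫ x, ∫ y, g y ∂(κ x) ∂π' :=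
        integral_sub (hint hg) (hint (H.integral_mem_wBounded hg))
    _ = ∫ x, ∫ y, g y ∂(κ' x) ∂π' - ∫ x, ∫ y, g y ∂(κ x) ∂π' := by
        congr 1
        exact ((H'.invariant_iff_integral_op hV).1 hπ' ⟨g, hg⟩).symm
    _ = _ := (integral_sub (hint (H'.integral_mem_wBounded hg))
        (hint (H.integral_mem_wBounded hg))).symm

lemma isStationary_stationary {κ : Kernel X X} (h : ∃! π : Measure X, IsStationary κ π) :
    IsStationary κ (stationary κ) := by
  rw [stationary, dif_pos h.exists]
  exact h.exists.choose_spec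

variable {d : ℕ}

lemma derivKernel_const_mul (P : (Fin d → ℝ) → Kernel X X) (p : (Fin d → ℝ) → X → X → ℝ)
    (θ₀ : Fin d → ℝ) (i : Fin d) (c : ℝ) (u : X → ℝ) (x : X) :
    derivKernel P p θ₀ i (fun y => c * u y) x = c * derivKernel P p θ₀ i u x := by
  simp only [derivKernel, mul_assoc, integral_const_mul]

lemma diffQuot_const_mul (P : (Fin d → ℝ) → Kernel X X) (θ₀ : Fin d → ℝ) (i : Fin d) (h c : ℝ)
    (u : X → ℝ) (x : X) : diffQuot P θ₀ i h (fun y => c * u y) x = c * diffQuot P θ₀ i h u x := by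
  simp only [diffQuot, integral_const_mul]
  ring

/-- The distance `|||(P(θ₀ + h e_i) - P(θ₀)) / h - P^(i)(θ₀)|||_V`, as a real number. -/
def derivError (V : X → ℝ) (P : (Fin d → ℝ) → Kernel X X) (p : (Fin d → ℝ) → X → X → ℝ)
    (θ₀ : Fin d → ℝ) (i : Fin d) (h : ℝ) : ℝ :=
  (opNorm V fun u x => diffQuot P θ₀ i h u x - derivKernel P p θ₀ i u x).toReal

lemma derivError_nonneg (V : X → ℝ) (P : (Fin d → ℝ) → Kernel X X) (p : (Fin d → ℝ) → X → X → ℝ)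
    (θ₀ : Fin d → ℝ) (i : Fin d) (h : ℝ) : 0 ≤ derivError V P p θ₀ i h :=
  ENNReal.toReal_nonneg

end Perturbation

section DriftFamily

/-- A parametrized family of kernels with densities `p` with respect to `P θ₀`, differentiable at
`θ₀` in the `V`-operator norm, satisfying near `θ₀` a common drift inequality towards small sets;
the small set and the minorizing measure may depend on the parameter. -/
structure DifferentiableDriftFamily {d : ℕ} (Θ : Set (Fin d → ℝ))
    (P : (Fin d → ℝ) → Kernel X X) (p : (Fin d → ℝ) → X → X → ℝ) (θ₀ : Fin d → ℝ) (ε : ℝ)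
    (V : X → ℝ) (lam b : ℝ) : Prop where
  eps_pos : 0 < ε
  mem : θ₀ ∈ Θ
  axes : ∀ i : Fin d, ∀ᶠ h : ℝ in 𝓝 0, θ₀ + h • Pi.single i 1 ∈ Θ
  driftMinorization : ∀ θ ∈ box Θ θ₀ ε, ∃ K δ m ν, DriftMinorization (P θ) K δ m ν V lam b
  density_measurable : ∀ θ ∈ box Θ θ₀ ε, Measurable (Function.uncurry (p θ))
  density_nonneg : ∀ θ ∈ box Θ θ₀ ε, ∀ x y, 0 ≤ p θ x y
  density : ∀ θ ∈ box Θ θ₀ ε, ∀ x,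
    P θ x = (P θ₀ x).withDensity (fun y => ENNReal.ofReal (p θ x y))
  density_differentiable : ∀ x y, HasGradientAt (fun θ => p θ x y) θ₀
  deriv_integrable : ∀ i : Fin d, ∀ x,
    Integrable (fun y => V y * partialDeriv i (fun θ => p θ x y) θ₀) (P θ₀ x)
  deriv_bounded : ∀ i : Fin d, opNorm V (derivKernel P p θ₀ i) < ∞
  deriv_limit : ∀ i : Fin d, Tendsto
    (fun h : ℝ => opNorm V (fun u x => diffQuot P θ₀ i h u x - derivKernel P p θ₀ i u x))
    (𝓝[≠] 0) (𝓝 0)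
  fisher_bounded : ∀ i : Fin d, wnorm V (fun x =>
    ∫⁻ y, ENNReal.ofReal ((partialDeriv i (fun θ => p θ x y) θ₀) ^ 2) ∂(P θ₀ x)) < ∞

namespace StandingAssumption

variable {d : ℕ} {Θ : Set (Fin d → ℝ)} {P : (Fin d → ℝ) → Kernel X X}
  {p : (Fin d → ℝ) → X → X → ℝ} {θ₀ : Fin d → ℝ} {ε : ℝ} {K : Set X} {δ : ℝ} {m : ℕ}
  {ν : Measure X} {V : X → ℝ} {lam b : ℝ} {f : X → ℝ}
variable (hA : StandingAssumption Θ P p θ₀ ε K δ m ν V lam b f)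
include hA

lemma isWeight : IsWeight V := ⟨hA.V_measurable, hA.one_le_V⟩

lemma driftMinorization {θ : Fin d → ℝ} (hθ : θ ∈ box Θ θ₀ ε) :
    DriftMinorization (P θ) K δ m ν V lam (max b 1) where
  isMarkovKernel := hA.markov θ hθ.1
  isWeight := hA.isWeight
  measurableSet_small := hA.small_measurable
  delta_pos := hA.delta_pos
  m_ne_zero := Nat.one_le_iff_ne_zero.1 hA.one_le_m
  isProbabilityMeasure := hA.prob
  smul_le_pow := hA.small θ hθ
  lam_nonneg := hA.lam_pos.le
  lam_lt_one := hA.lam_lt_one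
  b_pos := lt_max_of_lt_right one_pos
  lintegral_le x := by
    refine (hA.drift θ hθ x).trans (ENNReal.ofReal_le_ofReal ?_)
    gcongr
    exact le_max_left _ _

lemma differentiableDriftFamily : DifferentiableDriftFamily Θ P p θ₀ ε V lam (max b 1) where
  __ := hA
  driftMinorization _ hθ := ⟨K, δ, m, ν, hA.driftMinorization hθ⟩

lemma f_mem : f ∈ wBounded fun x => √(V x) :=
  ⟨hA.f_measurable, _, abs_le_wnorm_mul hA.isWeight.sqrt.pos hA.f_bounded.ne⟩

end StandingAssumption

namespace DifferentiableDriftFamily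

variable {d : ℕ} {Θ : Set (Fin d → ℝ)} {P : (Fin d → ℝ) → Kernel X X}
  {p : (Fin d → ℝ) → X → X → ℝ} {θ₀ : Fin d → ℝ} {ε : ℝ} {V : X → ℝ} {lam b : ℝ}
variable (hA : DifferentiableDriftFamily Θ P p θ₀ ε V lam b)
include hA

lemma mem_box : θ₀ ∈ box Θ θ₀ ε := ⟨hA.mem, fun i => by simpa using hA.eps_pos⟩

lemma eventually_mem_box (i : Fin d) :
    ∀ᶠ h : ℝ in 𝓝[≠] 0, θ₀ + h • Pi.single i 1 ∈ box Θ θ₀ ε := by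
  refine nhdsWithin_le_nhds ?_
  filter_upwards [hA.axes i, Metric.ball_mem_nhds (0 : ℝ) hA.eps_pos] with h hmem hball
  refine ⟨hmem, fun j => ?_⟩
  rcases eq_or_ne j i with rfl | hj
  · simpa using hball
  · simpa [hj] using hA.eps_pos

lemma affineDrift {θ : Fin d → ℝ} (hθ : θ ∈ box Θ θ₀ ε) : AffineDrift (P θ) V lam b := by
  obtain ⟨K, δ, m, ν, H⟩ := hA.driftMinorization θ hθ
  exact H.affineDrift

lemma lam_lt_one : lam < 1 := by
  obtain ⟨K, δ, m, ν, H⟩ := hA.driftMinorization θ₀ hA.mem_box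
  exact H.lam_lt_one

lemma isWeight : IsWeight V := (hA.affineDrift hA.mem_box).isWeight

lemma isMarkovKernel : IsMarkovKernel (P θ₀) := (hA.affineDrift hA.mem_box).isMarkovKernel

section Score

lemma measurable_partialDeriv (i : Fin d) :
    Measurable (Function.uncurry fun x y => partialDeriv i (fun θ => p θ x y) θ₀) := by
  obtain ⟨t, ht⟩ := exists_seq_tendsto (𝓝[≠] (0 : ℝ))
  obtain ⟨N, hN⟩ := eventually_atTop.1 (ht.eventually (hA.eventually_mem_box i))
  have htN : Tendsto (fun n => t (n + N)) atTop (𝓝[≠] 0) := ht.comp (tendsto_add_atTop_nat N)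
  refine measurable_of_tendsto_metrizable (f := fun n z => (t (n + N))⁻¹ •
    (Function.uncurry (p (θ₀ + t (n + N) • Pi.single i 1)) z - Function.uncurry (p θ₀) z))
    (fun n => ?_) (tendsto_pi_nhds.2 fun z => ?_)
  · exact ((hA.density_measurable _ (hN (n + N) (Nat.le_add_left N n))).sub
      (hA.density_measurable _ hA.mem_box)).const_smul (t (n + N))⁻¹
  · exact (hA.density_differentiable z.1 z.2 i).hasLineDerivAt.tendsto_slope_zero.comp htN

lemma derivKernel_mem_wBounded (i : Fin d) {u : X → ℝ} (hu : u ∈ wBounded V) :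
    derivKernel P p θ₀ i u ∈ wBounded V := by
  have := hA.isMarkovKernel
  obtain ⟨M, hM⟩ := hu.2
  refine ⟨?_, M * (opNorm V (derivKernel P p θ₀ i)).toReal, abs_apply_le_opNorm hA.isWeight.pos
    (derivKernel_const_mul P p θ₀ i) (hA.deriv_bounded i).ne hu.1 hM⟩
  have hmeas : Measurable (Function.uncurry fun x y =>
      u y * partialDeriv i (fun θ => p θ x y) θ₀) :=
    (hu.1.comp measurable_snd).mul (hA.measurable_partialDeriv i)
  exact (hmeas.stronglyMeasurable.integral_kernel_prod_right (κ := P θ₀)).measurable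

lemma diffQuot_mem_wBounded {i : Fin d} {t : ℝ} (hθ : θ₀ + t • Pi.single i 1 ∈ box Θ θ₀ ε)
    {g : X → ℝ} (hg : g ∈ wBounded V) : diffQuot P θ₀ i t g ∈ wBounded V := by
  convert (wBounded V).smul_mem t⁻¹ ((wBounded V).sub_mem
    ((hA.affineDrift hθ).integral_mem_wBounded hg)
    ((hA.affineDrift hA.mem_box).integral_mem_wBounded hg)) using 1
  funext x
  simp [diffQuot, div_eq_inv_mul]

lemma tendsto_derivError (i : Fin d) : Tendsto (derivError V P p θ₀ i) (𝓝[≠] 0) (𝓝 0) :=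
  (ENNReal.tendsto_toReal ENNReal.zero_ne_top).comp (hA.deriv_limit i)

lemma eventually_abs_diffQuot_sub_le (i : Fin d) {u : X → ℝ} (hu : Measurable u) {M : ℝ}
    (hM : ∀ x, |u x| ≤ M * V x) : ∀ᶠ h in 𝓝[≠] (0 : ℝ), ∀ x,
      |diffQuot P θ₀ i h u x - derivKernel P p θ₀ i u x| ≤ M * derivError V P p θ₀ i h * V x := by
  filter_upwards [(hA.deriv_limit i).eventually (gt_mem_nhds ENNReal.zero_lt_top)] with h hfin
  refine abs_apply_le_opNorm (T := fun u x => diffQuot P θ₀ i h u x - derivKernel P p θ₀ i u x)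
    hA.isWeight.pos (fun c u x => ?_) hfin.ne hu hM
  rw [diffQuot_const_mul, derivKernel_const_mul, mul_sub]

lemma integral_partialDeriv_eq_zero (i : Fin d) (x : X) :
    ∫ y, partialDeriv i (fun θ => p θ x y) θ₀ ∂(P θ₀ x) = 0 := by
  have := hA.isMarkovKernel
  have hbound : ∀ᶠ h in 𝓝[≠] (0 : ℝ),
      |derivKernel P p θ₀ i (fun _ => 1) x| ≤ derivError V P p θ₀ i h * V x := by
    filter_upwards [hA.eventually_mem_box i, hA.eventually_abs_diffQuot_sub_le i (u := fun _ => 1)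
      (M := 1) measurable_const fun x => by simpa using hA.isWeight.one_le x] with h hmem hle
    have := (hA.affineDrift hmem).isMarkovKernel
    have hzero : diffQuot P θ₀ i h (fun _ => 1) x = 0 := by simp [diffQuot]
    simpa only [hzero, zero_sub, abs_neg, one_mul] using hle x
  have hlim := (hA.tendsto_derivError i).mul_const (V x)
  rw [zero_mul] at hlim
  simpa [derivKernel] using abs_nonpos_iff.1 (ge_of_tendsto hlim hbound)

end Score

section SteadyState

variable [Nonempty X]

lemma existsUnique_stationary {θ : Fin d → ℝ} (hθ : θ ∈ box Θ θ₀ ε) :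
    ∃! π : Measure X, IsStationary (P θ) π := by
  obtain ⟨K, δ, m, ν, H⟩ := hA.driftMinorization θ hθ
  exact H.existsUnique_stationary

lemma isStationary_stationary {θ : Fin d → ℝ} (hθ : θ ∈ box Θ θ₀ ε) :
    IsStationary (P θ) (stationary (P θ)) :=
  LRGradient.isStationary_stationary (hA.existsUnique_stationary hθ)

lemma integrable_weight_stationary {θ : Fin d → ℝ} (hθ : θ ∈ box Θ θ₀ ε) :
    Integrable V (stationary (P θ)) := by
  have := (hA.isStationary_stationary hθ).1
  exact (hA.affineDrift hθ).integrable_of_invariant hA.lam_lt_one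
    (hA.isStationary_stationary hθ).2

lemma integrable_stationary {θ : Fin d → ℝ} (hθ : θ ∈ box Θ θ₀ ε) {u : X → ℝ}
    (hu : u ∈ wBounded V) : Integrable u (stationary (P θ)) :=
  wBounded_integrable ⟨u, hu⟩ (hA.integrable_weight_stationary hθ)

lemma abs_steadyState_le {θ : Fin d → ℝ} (hθ : θ ∈ box Θ θ₀ ε) {u : X → ℝ} {M : ℝ}
    (hM0 : 0 ≤ M) (hM : ∀ x, |u x| ≤ M * V x) : |steadyState P u θ| ≤ M * (b / (1 - lam)) := by
  have := (hA.isStationary_stationary hθ).1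
  calc |steadyState P u θ| ≤ ∫ x, M * V x ∂(stationary (P θ)) := by
        rw [steadyState, ← Real.norm_eq_abs]
        exact norm_integral_le_of_norm_le ((hA.integrable_weight_stationary hθ).const_mul M)
          (ae_of_all _ hM)
    _ = M * ∫ x, V x ∂(stationary (P θ)) := integral_const_mul _ _
    _ ≤ M * (b / (1 - lam)) := mul_le_mul_of_nonneg_left
        ((hA.affineDrift hθ).integral_le_of_invariant hA.lam_lt_one
          (hA.isStationary_stationary hθ).2) hM0

lemma steadyState_sub_eq {i : Fin d} {t : ℝ} (ht : t ≠ 0)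
    (hθ : θ₀ + t • Pi.single i 1 ∈ box Θ θ₀ ε) {u g : X → ℝ} (hu : u ∈ wBounded V)
    (hg : g ∈ wBounded V)
    (hP : ∀ x, g x - ∫ y, g y ∂(P θ₀ x) = u x - steadyState P u θ₀) :
    steadyState P u (θ₀ + t • Pi.single i 1) - steadyState P u θ₀
      = t * steadyState P (diffQuot P θ₀ i t g) (θ₀ + t • Pi.single i 1) := by
  have hst := hA.isStationary_stationary hθ
  have := hst.1
  calc _ = ∫ x, ((∫ y, g y ∂(P (θ₀ + t • Pi.single i 1) x)) - ∫ y, g y ∂(P θ₀ x))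
        ∂(stationary (P (θ₀ + t • Pi.single i 1))) :=
        (hA.affineDrift hA.mem_box).integral_sub_eq_of_poisson (hA.affineDrift hθ) hst.2
          (hA.integrable_weight_stationary hθ) hu hg hP
    _ = _ := by
        rw [steadyState, ← integral_const_mul]
        simp only [diffQuot, mul_div_cancel₀ _ ht]

lemma tendsto_steadyState_diffQuot_sub (i : Fin d) {g : X → ℝ} (hg : g ∈ wBounded V) :
    Tendsto (fun t : ℝ => steadyState P (diffQuot P θ₀ i t g) (θ₀ + t • Pi.single i 1)
      - steadyState P (derivKernel P p θ₀ i g) (θ₀ + t • Pi.single i 1)) (𝓝[≠] 0) (𝓝 0) := by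
  obtain ⟨M, hM0, hM⟩ := hA.isWeight.exists_abs_le ⟨g, hg⟩
  have hlim := ((hA.tendsto_derivError i).const_mul M).mul_const (b / (1 - lam))
  rw [mul_zero, zero_mul] at hlim
  refine squeeze_zero_norm' ?_ hlim
  filter_upwards [hA.eventually_abs_diffQuot_sub_le i hg.1 hM, hA.eventually_mem_box i]
    with t hle hmem
  have hsub := integral_sub (hA.integrable_stationary hmem (hA.diffQuot_mem_wBounded hmem hg))
    (hA.integrable_stationary hmem (hA.derivKernel_mem_wBounded i hg))
  rw [Real.norm_eq_abs, steadyState, steadyState, ← hsub]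
  exact hA.abs_steadyState_le hmem (mul_nonneg hM0 (derivError_nonneg V P p θ₀ i t)) hle

lemma tendsto_steadyState {u g : X → ℝ} (i : Fin d) (hu : u ∈ wBounded V) (hg : g ∈ wBounded V)
    (hP : ∀ x, g x - ∫ y, g y ∂(P θ₀ x) = u x - steadyState P u θ₀) :
    Tendsto (fun t : ℝ => steadyState P u (θ₀ + t • Pi.single i 1)) (𝓝[≠] 0)
      (𝓝 (steadyState P u θ₀)) := by
  obtain ⟨M, hM0, hM⟩ := hA.isWeight.exists_abs_le ⟨_, hA.derivKernel_mem_wBounded i hg⟩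
  have hdiff := (hA.tendsto_steadyState_diffQuot_sub i hg).norm
  rw [norm_zero] at hdiff
  have hid : Tendsto (fun t : ℝ => |t|) (𝓝[≠] 0) (𝓝 0) := by
    simpa using (continuous_abs.tendsto (0 : ℝ)).mono_left nhdsWithin_le_nhds
  have hlim := hid.mul_const (1 + M * (b / (1 - lam)))
  rw [zero_mul] at hlim
  refine tendsto_sub_nhds_zero_iff.1 (squeeze_zero_norm' ?_ hlim)
  filter_upwards [self_mem_nhdsWithin, hA.eventually_mem_box i, hdiff.eventually_le_const one_pos]
    with t ht hmem hle
  rw [hA.steadyState_sub_eq ht hmem hu hg hP, Real.norm_eq_abs, abs_mul]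
  refine mul_le_mul_of_nonneg_left ?_ (abs_nonneg t)
  have hderiv := hA.abs_steadyState_le hmem hM0 hM
  exact sub_le_iff_le_add.1 ((abs_sub_abs_le_abs_sub _ _).trans hle) |>.trans
    (add_le_add_right hderiv 1)

theorem hasLineDerivAt_steadyState (i : Fin d) {u g : X → ℝ} (hu : u ∈ wBounded V)
    (hg : g ∈ wBounded V)
    (hP : ∀ x, g x - ∫ y, g y ∂(P θ₀ x) = u x - steadyState P u θ₀) :
    HasLineDerivAt ℝ (steadyState P u) (steadyState P (derivKernel P p θ₀ i g) θ₀) θ₀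
      (Pi.single i 1) := by
  have hst := hA.isStationary_stationary hA.mem_box
  have := hst.1
  obtain ⟨K, δ, m, ν, H⟩ := hA.driftMinorization θ₀ hA.mem_box
  have hderiv := hA.derivKernel_mem_wBounded i hg
  obtain ⟨g', hg', hP'⟩ := H.exists_poisson hst.2 hderiv
  have hlim := (hA.tendsto_steadyState_diffQuot_sub i hg).add
    (hA.tendsto_steadyState i hderiv hg' hP')
  rw [zero_add] at hlim
  refine hasLineDerivAt_iff_tendsto_slope_zero.2 (hlim.congr' ?_)
  filter_upwards [self_mem_nhdsWithin, hA.eventually_mem_box i] with t ht hmem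
  rw [sub_add_cancel, hA.steadyState_sub_eq ht hmem hu hg hP, smul_eq_mul, inv_mul_cancel_left₀ ht]

end SteadyState

end DifferentiableDriftFamily

end DriftFamily

section MarkovChain

variable {Ω : Type*}

/-- The σ-algebra generated by the process up to time `n`. -/
abbrev history (Φ : ℕ → Ω → X) (n : ℕ) : MeasurableSpace Ω :=
  ⨆ j ∈ Finset.range (n + 1), MeasurableSpace.comap (Φ j) inferInstance

lemma measurable_history (Φ : ℕ → Ω → X) {j n : ℕ} (hj : j ≤ n) :
    Measurable[history Φ n] (Φ j) :=
  measurable_iff_comap_le.2 (le_iSup₂_of_le j (Finset.mem_range_succ_iff.2 hj) le_rfl)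

variable [mΩ : MeasurableSpace Ω] {Pr : Measure Ω} {κ : Kernel X X} {μ : Measure X}
  {Φ : ℕ → Ω → X}

namespace IsMarkovChain

section Transition

variable (hΦ : IsMarkovChain Pr κ μ Φ)
include hΦ

lemma history_le (n : ℕ) : history Φ n ≤ mΩ :=
  iSup₂_le fun j _ => (hΦ.measurable j).comap_le

lemma measurable_pair (n : ℕ) : Measurable fun ω => (Φ n ω, Φ (n + 1) ω) :=
  (hΦ.measurable n).prodMk (hΦ.measurable (n + 1))

variable [IsFiniteMeasure Pr] [IsFiniteKernel κ]

lemma map_restrict_pair {n : ℕ} {B : Set Ω} (hB : MeasurableSet[history Φ n] B) :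
    (Pr.restrict B).map (fun ω => (Φ n ω, Φ (n + 1) ω)) = ((Pr.restrict B).map (Φ n)) ⊗ₘ κ := by
  refine Measure.ext_prod fun {s t} hs ht => ?_
  have hs' : MeasurableSet[history Φ n] (Φ n ⁻¹' s) := measurable_history Φ le_rfl hs
  rw [Measure.map_apply (hΦ.measurable_pair n) (hs.prod ht),
    Measure.restrict_apply (hΦ.measurable_pair n (hs.prod ht)),
    Measure.compProd_apply_prod hs ht,
    setLIntegral_map hs (κ.measurable_coe ht) (hΦ.measurable n),
    Measure.restrict_restrict (hΦ.measurable n hs), Set.inter_comm (Φ n ⁻¹' s) B,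
    ← hΦ.markov n _ t (hB.inter hs') ht]
  congr 1
  ext ω
  simp only [Set.mem_inter_iff, Set.mem_preimage, Set.mem_prod]
  tauto

lemma map_pair (n : ℕ) :
    Pr.map (fun ω => (Φ n ω, Φ (n + 1) ω)) = (Pr.map (Φ n)) ⊗ₘ κ := by
  simpa only [Measure.restrict_univ] using
    hΦ.map_restrict_pair (n := n) (B := Set.univ) MeasurableSet.univ

lemma map_succ (n : ℕ) : Pr.map (Φ (n + 1)) = (Pr.map (Φ n)).bind κ := by
  rw [← Measure.snd_compProd, ← hΦ.map_pair, Measure.snd,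
    Measure.map_map measurable_snd (hΦ.measurable_pair n)]
  rfl

lemma setIntegral_pair {n : ℕ} {B : Set Ω} (hB : MeasurableSet[history Φ n] B) {u : X × X → ℝ}
    (hu : Measurable u) (hint : Integrable (fun ω => u (Φ n ω, Φ (n + 1) ω)) Pr) :
    ∫ ω in B, u (Φ n ω, Φ (n + 1) ω) ∂Pr = ∫ ω in B, ∫ y, u (Φ n ω, y) ∂(κ (Φ n ω)) ∂Pr := by
  have hpair := (hΦ.measurable_pair n).aemeasurable (μ := Pr.restrict B)
  have hcomp : Integrable u (((Pr.restrict B).map (Φ n)) ⊗ₘ κ) := by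
    rw [← hΦ.map_restrict_pair hB, integrable_map_measure hu.aestronglyMeasurable hpair]
    exact hint.restrict
  rw [← integral_map hpair hu.aestronglyMeasurable, hΦ.map_restrict_pair hB,
    Measure.integral_compProd hcomp, integral_map (hΦ.measurable n).aemeasurable]
  exact hu.stronglyMeasurable.integral_kernel_prod_right'.aestronglyMeasurable

lemma integral_pair (n : ℕ) {u : X × X → ℝ}
    (hu : Measurable u) (hint : Integrable (fun ω => u (Φ n ω, Φ (n + 1) ω)) Pr) :
    ∫ ω, u (Φ n ω, Φ (n + 1) ω) ∂Pr = ∫ ω, ∫ y, u (Φ n ω, y) ∂(κ (Φ n ω)) ∂Pr := by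
  simpa only [Measure.restrict_univ] using
    hΦ.setIntegral_pair (n := n) (B := Set.univ) MeasurableSet.univ hu hint

lemma lintegral_pair (n : ℕ) {u : X × X → ℝ≥0∞} (hu : Measurable u) :
    ∫⁻ ω, u (Φ n ω, Φ (n + 1) ω) ∂Pr = ∫⁻ ω, ∫⁻ y, u (Φ n ω, y) ∂(κ (Φ n ω)) ∂Pr := by
  rw [← lintegral_map hu (hΦ.measurable_pair n), hΦ.map_pair, Measure.lintegral_compProd hu,
    lintegral_map hu.lintegral_kernel_prod_right' (hΦ.measurable n)]

lemma ae_pair (n : ℕ) {q : X × X → Prop} (hq : MeasurableSet {z | q z})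
    (h : ∀ x, ∀ᵐ y ∂(κ x), q (x, y)) : ∀ᵐ ω ∂Pr, q (Φ n ω, Φ (n + 1) ω) := by
  refine (ae_map_iff (hΦ.measurable_pair n).aemeasurable hq).1 ?_
  rw [hΦ.map_pair, Measure.ae_compProd_iff hq]
  exact ae_of_all _ h

lemma condExp_pair_eq_zero {n : ℕ} {u : X × X → ℝ} (hu : Measurable u)
    (hu0 : ∀ x, ∫ y, u (x, y) ∂(κ x) = 0)
    (hint : Integrable (fun ω => u (Φ n ω, Φ (n + 1) ω)) Pr) :
    Pr[fun ω => u (Φ n ω, Φ (n + 1) ω) | history Φ n] =ᵐ[Pr] 0 := by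
  refine (ae_eq_condExp_of_forall_setIntegral_eq (hΦ.history_le n) hint
    (fun _ _ _ => integrableOn_zero) (fun B hB _ => ?_)
    stronglyMeasurable_zero.aestronglyMeasurable).symm
  rw [hΦ.setIntegral_pair hB hu hint]
  simp only [hu0]

lemma integral_mul_pair_eq_zero {n : ℕ} {u : X × X → ℝ} (hu : Measurable u)
    (hu0 : ∀ x, ∫ y, u (x, y) ∂(κ x) = 0)
    (huL : MemLp (fun ω => u (Φ n ω, Φ (n + 1) ω)) 2 Pr) {Z : Ω → ℝ}
    (hZ : Measurable[history Φ n] Z) (hZL : MemLp Z 2 Pr) :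
    ∫ ω, Z ω * u (Φ n ω, Φ (n + 1) ω) ∂Pr = 0 := by
  have hint := huL.integrable one_le_two
  have hcond : Pr[Z * fun ω => u (Φ n ω, Φ (n + 1) ω) | history Φ n] =ᵐ[Pr] 0 := by
    refine (condExp_mul_of_stronglyMeasurable_left hZ.stronglyMeasurable (hZL.integrable_mul huL)
      hint).trans ?_
    filter_upwards [hΦ.condExp_pair_eq_zero hu hu0 hint] with ω hω
    rw [Pi.mul_apply, hω, Pi.zero_apply, mul_zero]
  calc ∫ ω, Z ω * u (Φ n ω, Φ (n + 1) ω) ∂Pr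
      = ∫ ω, (Pr[Z * fun ω => u (Φ n ω, Φ (n + 1) ω) | history Φ n]) ω ∂Pr :=
        (integral_condExp (hΦ.history_le n)).symm
    _ = 0 := integral_eq_zero_of_ae hcond

end Transition

section Drift

variable [IsProbabilityMeasure Pr] {V : X → ℝ} {lam C : ℝ} (hΦ : IsMarkovChain Pr κ μ Φ)
  (H : AffineDrift κ V lam C) (hμ : Integrable V μ)
include hΦ H hμ

lemma integrable_weight_map (n : ℕ) : Integrable V (Pr.map (Φ n)) := by
  have := H.isMarkovKernel
  induction n with
  | zero => rwa [hΦ.initial]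
  | succ n ih =>
    rw [hΦ.map_succ]
    exact H.integrable_bind ih

lemma integrable_comp (n : ℕ) {φ : X → ℝ} (hφ : φ ∈ wBounded V) :
    Integrable (fun ω => φ (Φ n ω)) Pr :=
  (integrable_map_measure hφ.1.aestronglyMeasurable (hΦ.measurable n).aemeasurable).1
    (wBounded_integrable ⟨φ, hφ⟩ (hΦ.integrable_weight_map H hμ n))

lemma integrable_weight_comp (n : ℕ) : Integrable (fun ω => V (Φ n ω)) Pr :=
  hΦ.integrable_comp H hμ n H.isWeight.self.2

lemma integral_comp_succ (n : ℕ) {φ : X → ℝ} (hφ : φ ∈ wBounded V) :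
    ∫ ω, φ (Φ (n + 1) ω) ∂Pr = ∫ ω, ∫ y, φ y ∂(κ (Φ n ω)) ∂Pr := by
  have := H.isMarkovKernel
  exact hΦ.integral_pair n (u := fun z => φ z.2) (hφ.1.comp measurable_snd)
    (hΦ.integrable_comp H hμ (n + 1) hφ)

lemma integral_weight_comp_le (hlam : lam < 1) (n : ℕ) :
    ∫ ω, V (Φ n ω) ∂Pr ≤ ∫ x, V x ∂μ + C / (1 - lam) := by
  have hpos : 0 < 1 - lam := sub_pos.2 hlam
  have hI : 0 ≤ ∫ x, V x ∂μ := integral_nonneg fun x => (H.isWeight.pos x).le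
  induction n with
  | zero =>
    rw [← integral_map (hΦ.measurable 0).aemeasurable H.isWeight.measurable.aestronglyMeasurable,
      hΦ.initial]
    exact le_add_of_nonneg_right (div_nonneg H.const_nonneg hpos.le)
  | succ n ih =>
    have hint := (hΦ.integrable_weight_comp H hμ n).const_mul lam
    calc ∫ ω, V (Φ (n + 1) ω) ∂Pr = ∫ ω, ∫ y, V y ∂(κ (Φ n ω)) ∂Pr :=
          hΦ.integral_comp_succ H hμ n H.isWeight.self.2
      _ ≤ ∫ ω, (lam * V (Φ n ω) + C) ∂Pr :=
          integral_mono (hΦ.integrable_comp H hμ n (H.integral_mem_wBounded H.isWeight.self.2))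
            (hint.add (integrable_const C)) fun ω => H.integral_le _
      _ = lam * ∫ ω, V (Φ n ω) ∂Pr + C := by
          rw [integral_add hint (integrable_const C), integral_const_mul, integral_const,
            probReal_univ, one_smul]
      _ ≤ lam * (∫ x, V x ∂μ + C / (1 - lam)) + C := by gcongr; exact H.lam_nonneg
      _ = lam * ∫ x, V x ∂μ + C / (1 - lam) := by field_simp; ring
      _ ≤ ∫ x, V x ∂μ + C / (1 - lam) := by
          gcongr
          exact mul_le_of_le_one_left hI hlam.le

lemma abs_integral_comp_le (hlam : lam < 1) (n : ℕ) {φ : X → ℝ} {M : ℝ} (hM0 : 0 ≤ M)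
    (hM : ∀ x, |φ x| ≤ M * V x) :
    |∫ ω, φ (Φ n ω) ∂Pr| ≤ M * (∫ x, V x ∂μ + C / (1 - lam)) := by
  calc |∫ ω, φ (Φ n ω) ∂Pr| ≤ ∫ ω, M * V (Φ n ω) ∂Pr := by
        rw [← Real.norm_eq_abs]
        exact norm_integral_le_of_norm_le ((hΦ.integrable_weight_comp H hμ n).const_mul M)
          (ae_of_all _ fun ω => hM _)
    _ = M * ∫ ω, V (Φ n ω) ∂Pr := integral_const_mul _ _
    _ ≤ M * (∫ x, V x ∂μ + C / (1 - lam)) :=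
        mul_le_mul_of_nonneg_left (hΦ.integral_weight_comp_le H hμ hlam n) hM0

lemma memLp_comp (n : ℕ) {φ : X → ℝ} (hφ : φ ∈ wBounded fun x => √(V x)) :
    MemLp (fun ω => φ (Φ n ω)) 2 Pr :=
  (memLp_two_iff_integrable_sq (hφ.1.comp (hΦ.measurable n)).aestronglyMeasurable).2
    (hΦ.integrable_comp H hμ n (H.isWeight.sq_mem_wBounded hφ))

lemma sum_integral_comp_eq_of_poisson {φ g : X → ℝ} {c : ℝ} (hg : g ∈ wBounded V)
    (hP : ∀ x, g x - ∫ y, g y ∂(κ x) = φ x - c) (n : ℕ) :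
    ∑ k ∈ Finset.range n, ∫ ω, φ (Φ k ω) ∂Pr
      = n * c + (∫ ω, g (Φ 0 ω) ∂Pr - ∫ ω, g (Φ n ω) ∂Pr) := by
  have hstep (k : ℕ) :
      ∫ ω, φ (Φ k ω) ∂Pr = c + (∫ ω, g (Φ k ω) ∂Pr - ∫ ω, g (Φ (k + 1) ω) ∂Pr) := by
    have hgk := hΦ.integrable_comp H hμ k hg
    have hPgk := hΦ.integrable_comp H hμ k (H.integral_mem_wBounded hg)
    have hsub : Integrable (fun ω => g (Φ k ω) - ∫ y, g y ∂(κ (Φ k ω))) Pr := hgk.sub hPgk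
    have hφ (x : X) : φ x = c + (g x - ∫ y, g y ∂(κ x)) := by rw [hP, add_sub_cancel]
    simp_rw [hφ]
    rw [integral_add (integrable_const c) hsub, integral_sub hgk hPgk,
      ← hΦ.integral_comp_succ H hμ k hg, integral_const, probReal_univ, one_smul]
  simp_rw [hstep]
  rw [Finset.sum_add_distrib, Finset.sum_range_sub', Finset.sum_const, Finset.card_range,
    nsmul_eq_mul]

end Drift

theorem tendsto_average_integral_comp [IsProbabilityMeasure Pr] {K : Set X} {δ : ℝ} {m : ℕ}
    {ν : Measure X} {V : X → ℝ} {lam b : ℝ} (hΦ : IsMarkovChain Pr κ μ Φ)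
    (H : DriftMinorization κ K δ m ν V lam b) (hμ : Integrable V μ) {π : Measure X}
    [IsProbabilityMeasure π] (hπ : Kernel.Invariant κ π) {φ : X → ℝ} (hφ : φ ∈ wBounded V) :
    Tendsto (fun n : ℕ => (1 / (n : ℝ)) * ∑ k ∈ Finset.range n, ∫ ω, φ (Φ k ω) ∂Pr) atTop
      (𝓝 (∫ x, φ x ∂π)) := by
  obtain ⟨g, hg, hP⟩ := H.exists_poisson hπ hφ
  obtain ⟨M, hM0, hM⟩ := H.isWeight.exists_abs_le ⟨g, hg⟩
  have hG (n : ℕ) := hΦ.abs_integral_comp_le H.affineDrift hμ H.lam_lt_one n hM0 hM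
  have hrem : Tendsto (fun n : ℕ => (1 / (n : ℝ)) * (∫ ω, g (Φ 0 ω) ∂Pr - ∫ ω, g (Φ n ω) ∂Pr))
      atTop (𝓝 0) := by
    refine squeeze_zero_norm (fun n => ?_) (tendsto_const_div_atTop_nhds_zero_nat
      (M * (∫ x, V x ∂μ + b / (1 - lam)) + M * (∫ x, V x ∂μ + b / (1 - lam))))
    rw [one_div_mul_eq_div, norm_div, Real.norm_natCast]
    gcongr
    exact (abs_sub _ _).trans (add_le_add (hG 0) (hG n))
  have hlim := hrem.const_add (∫ x, φ x ∂π)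
  rw [add_zero] at hlim
  refine hlim.congr' ?_
  filter_upwards [eventually_ne_atTop 0] with n hn
  rw [hΦ.sum_integral_comp_eq_of_poisson H.affineDrift hμ hg hP]
  field_simp

end IsMarkovChain

end MarkovChain

section MartingaleIncrement

variable {Ω : Type*}

lemma measurable_history_pair_comp (Φ : ℕ → Ω → X) {u : X × X → ℝ} (hu : Measurable u) {k n : ℕ}
    (hk : k < n) : Measurable[history Φ n] fun ω => u (Φ k ω, Φ (k + 1) ω) :=
  hu.comp ((measurable_history Φ hk.le).prodMk (measurable_history Φ hk))

/-- The sum of the increments `u (Φ k, Φ (k + 1))` over `k < n`. -/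
def incrementSum (Φ : ℕ → Ω → X) (u : X × X → ℝ) (n : ℕ) (ω : Ω) : ℝ :=
  ∑ k ∈ Finset.range n, u (Φ k ω, Φ (k + 1) ω)

omit [MeasurableSpace X] in
lemma incrementSum_zero (Φ : ℕ → Ω → X) (u : X × X → ℝ) (ω : Ω) : incrementSum Φ u 0 ω = 0 :=
  Finset.sum_range_zero _

omit [MeasurableSpace X] in
lemma incrementSum_succ (Φ : ℕ → Ω → X) (u : X × X → ℝ) (n : ℕ) (ω : Ω) :
    incrementSum Φ u (n + 1) ω = incrementSum Φ u n ω + u (Φ n ω, Φ (n + 1) ω) :=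
  Finset.sum_range_succ _ _

lemma measurable_incrementSum (Φ : ℕ → Ω → X) {u : X × X → ℝ} (hu : Measurable u) (n : ℕ) :
    Measurable[history Φ n] (incrementSum Φ u n) :=
  Finset.measurable_fun_sum _ fun _ hk =>
    measurable_history_pair_comp Φ hu (Finset.mem_range.1 hk)

variable [MeasurableSpace Ω]

/-- The functions `u` for which `u (Φ k, Φ (k + 1))` is a square-integrable martingale difference
sequence along a Markov chain `Φ` with kernel `κ`. -/
structure IsMartingaleIncrement (Pr : Measure Ω) (κ : Kernel X X) (Φ : ℕ → Ω → X)
    (u : X × X → ℝ) : Prop where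
  measurable : Measurable u
  integral_eq_zero : ∀ x, ∫ y, u (x, y) ∂(κ x) = 0
  memLp : ∀ n, MemLp (fun ω => u (Φ n ω, Φ (n + 1) ω)) 2 Pr

variable {Pr : Measure Ω} {κ : Kernel X X} {μ : Measure X} {Φ : ℕ → Ω → X} {u v : X × X → ℝ}

namespace IsMartingaleIncrement

lemma memLp_incrementSum (hu : IsMartingaleIncrement Pr κ Φ u) (n : ℕ) :
    MemLp (incrementSum Φ u n) 2 Pr :=
  memLp_finsetSum _ fun k _ => hu.memLp k

variable [IsFiniteMeasure Pr] [IsFiniteKernel κ]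

lemma integral_mul_eq_zero (hu : IsMartingaleIncrement Pr κ Φ u) (hΦ : IsMarkovChain Pr κ μ Φ)
    {n : ℕ} {Z : Ω → ℝ} (hZ : Measurable[history Φ n] Z) (hZL : MemLp Z 2 Pr) :
    ∫ ω, Z ω * u (Φ n ω, Φ (n + 1) ω) ∂Pr = 0 :=
  hΦ.integral_mul_pair_eq_zero hu.measurable hu.integral_eq_zero (hu.memLp n) hZ hZL

lemma integral_initial_mul_incrementSum_eq_zero (hu : IsMartingaleIncrement Pr κ Φ u)
    (hΦ : IsMarkovChain Pr κ μ Φ) {Z : X → ℝ} (hZ : Measurable Z)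
    (hZL : MemLp (fun ω => Z (Φ 0 ω)) 2 Pr) (n : ℕ) :
    ∫ ω, Z (Φ 0 ω) * incrementSum Φ u n ω ∂Pr = 0 := by
  simp only [incrementSum, Finset.mul_sum]
  have hint (k : ℕ) : Integrable (fun ω => Z (Φ 0 ω) * u (Φ k ω, Φ (k + 1) ω)) Pr :=
    hZL.integrable_mul (hu.memLp k)
  rw [integral_finsetSum _ fun k _ => hint k]
  exact Finset.sum_eq_zero fun k _ =>
    hu.integral_mul_eq_zero hΦ (hZ.comp (measurable_history Φ k.zero_le)) hZL

lemma integral_incrementSum_mul (hu : IsMartingaleIncrement Pr κ Φ u)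
    (hv : IsMartingaleIncrement Pr κ Φ v) (hΦ : IsMarkovChain Pr κ μ Φ) (n : ℕ) :
    ∫ ω, incrementSum Φ u n ω * incrementSum Φ v n ω ∂Pr
      = ∑ k ∈ Finset.range n, ∫ ω, u (Φ k ω, Φ (k + 1) ω) * v (Φ k ω, Φ (k + 1) ω) ∂Pr := by
  induction n with
  | zero => simp [incrementSum_zero]
  | succ n ih =>
    have hU := hu.memLp_incrementSum n
    have hV := hv.memLp_incrementSum n
    have hUV : Integrable (fun ω => incrementSum Φ u n ω * incrementSum Φ v n ω) Pr :=
      hU.integrable_mul hV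
    have hUv : Integrable (fun ω => incrementSum Φ u n ω * v (Φ n ω, Φ (n + 1) ω)) Pr :=
      hU.integrable_mul (hv.memLp n)
    have hVu : Integrable (fun ω => incrementSum Φ v n ω * u (Φ n ω, Φ (n + 1) ω)) Pr :=
      hV.integrable_mul (hu.memLp n)
    have huv : Integrable (fun ω => u (Φ n ω, Φ (n + 1) ω) * v (Φ n ω, Φ (n + 1) ω)) Pr :=
      (hu.memLp n).integrable_mul (hv.memLp n)
    have hUv0 := hv.integral_mul_eq_zero hΦ (measurable_incrementSum Φ hu.measurable n) hU
    have hVu0 := hu.integral_mul_eq_zero hΦ (measurable_incrementSum Φ hv.measurable n) hV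
    have hexpand (ω : Ω) : incrementSum Φ u (n + 1) ω * incrementSum Φ v (n + 1) ω
        = incrementSum Φ u n ω * incrementSum Φ v n ω
          + incrementSum Φ u n ω * v (Φ n ω, Φ (n + 1) ω)
          + (incrementSum Φ v n ω * u (Φ n ω, Φ (n + 1) ω)
            + u (Φ n ω, Φ (n + 1) ω) * v (Φ n ω, Φ (n + 1) ω)) := by
      rw [incrementSum_succ, incrementSum_succ]
      ring
    simp_rw [hexpand]
    rw [integral_add (hUV.fun_add hUv) (hVu.fun_add huv), integral_add hUV hUv,
      integral_add hVu huv, hUv0, hVu0, add_zero, zero_add, ih, Finset.sum_range_succ]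

lemma integral_incrementSum_sq_le (hu : IsMartingaleIncrement Pr κ Φ u)
    (hΦ : IsMarkovChain Pr κ μ Φ) {C : ℝ}
    (hC : ∀ k, ∫ ω, u (Φ k ω, Φ (k + 1) ω) ^ 2 ∂Pr ≤ C) (n : ℕ) :
    ∫ ω, incrementSum Φ u n ω ^ 2 ∂Pr ≤ n * C := by
  calc ∫ ω, incrementSum Φ u n ω ^ 2 ∂Pr
      = ∑ k ∈ Finset.range n, ∫ ω, u (Φ k ω, Φ (k + 1) ω) ^ 2 ∂Pr := by
        simpa only [pow_two] using hu.integral_incrementSum_mul hu hΦ n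
    _ ≤ ∑ _k ∈ Finset.range n, C := Finset.sum_le_sum fun k _ => hC k
    _ = n * C := by rw [Finset.sum_const, Finset.card_range, nsmul_eq_mul]

end IsMartingaleIncrement

lemma abs_integral_mul_le_sqrt_mul_sqrt {F G : Ω → ℝ} (hF : MemLp F 2 Pr) (hG : MemLp G 2 Pr) :
    |∫ ω, F ω * G ω ∂Pr| ≤ √(∫ ω, F ω ^ 2 ∂Pr) * √(∫ ω, G ω ^ 2 ∂Pr) := by
  have hofReal : ENNReal.ofReal 2 = 2 := ENNReal.ofReal_ofNat 2
  have hholder := integral_mul_norm_le_Lp_mul_Lq Real.HolderConjugate.two_two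
    (hofReal.symm ▸ hF) (hofReal.symm ▸ hG)
  simp only [Real.rpow_two, Real.norm_eq_abs, sq_abs, ← Real.sqrt_eq_rpow, ← abs_mul] at hholder
  exact (abs_integral_le_integral_abs).trans hholder

lemma tendsto_inv_mul_integral_mul_zero {F G : ℕ → Ω → ℝ} (hF : ∀ n, MemLp (F n) 2 Pr)
    (hG : ∀ n, MemLp (G n) 2 Pr) {A C : ℝ} (hA : ∀ n, ∫ ω, F n ω ^ 2 ∂Pr ≤ A)
    (hC : ∀ n : ℕ, ∫ ω, G n ω ^ 2 ∂Pr ≤ n * C) :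
    Tendsto (fun n : ℕ => (1 / (n : ℝ)) * ∫ ω, F n ω * G n ω ∂Pr) atTop (𝓝 0) := by
  have hlim : Tendsto (fun n : ℕ => √A * √C / √(n : ℝ)) atTop (𝓝 0) :=
    tendsto_const_nhds.div_atTop (Real.tendsto_sqrt_atTop.comp tendsto_natCast_atTop_atTop)
  refine squeeze_zero_norm (fun n => ?_) hlim
  calc ‖(1 / (n : ℝ)) * ∫ ω, F n ω * G n ω ∂Pr‖
      = |∫ ω, F n ω * G n ω ∂Pr| / n := by
        rw [one_div_mul_eq_div, norm_div, Real.norm_natCast, Real.norm_eq_abs]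
    _ ≤ √A * √(n * C) / n := by
        gcongr
        refine (abs_integral_mul_le_sqrt_mul_sqrt (hF n) (hG n)).trans ?_
        gcongr
        exacts [hA n, hC n]
    _ = √A * √C * (√n / n) := by
        rw [Real.sqrt_mul n.cast_nonneg]
        ring
    _ = √A * √C / √(n : ℝ) := by rw [Real.sqrt_div_self, div_eq_mul_inv]

/-- The increment `g(Φ_{k+1}) - E[g(Φ_{k+1}) | Φ_k]`, as a function of `(Φ_k, Φ_{k+1})`. -/
def centeredIncrement (κ : Kernel X X) (g : X → ℝ) (z : X × X) : ℝ :=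
  g z.2 - ∫ y, g y ∂(κ z.1)

omit [MeasurableSpace Ω] in
lemma sum_comp_eq_add_incrementSum {φ g : X → ℝ} {c : ℝ}
    (hP : ∀ x, g x - ∫ y, g y ∂(κ x) = φ x - c) (n : ℕ) (ω : Ω) :
    ∑ j ∈ Finset.range n, φ (Φ j ω)
      = (n * c + g (Φ 0 ω)) - g (Φ n ω) + incrementSum Φ (centeredIncrement κ g) n ω := by
  induction n with
  | zero => simp [incrementSum_zero]
  | succ n ih =>
    rw [Finset.sum_range_succ, ih, incrementSum_succ, centeredIncrement]
    push_cast
    linarith [hP (Φ n ω)]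

section Drift

variable [IsProbabilityMeasure Pr] {K : Set X} {δ : ℝ} {m : ℕ} {ν : Measure X} {V : X → ℝ}
  {lam b : ℝ} (H : DriftMinorization κ K δ m ν V lam b) (hΦ : IsMarkovChain Pr κ μ Φ)
  (hμ : Integrable V μ) {g : X → ℝ} (hg : g ∈ wBounded fun x => √(V x))
include H hΦ hμ hg

lemma isMartingaleIncrement_centeredIncrement :
    IsMartingaleIncrement Pr κ Φ (centeredIncrement κ g) where
  measurable := (hg.1.comp measurable_snd).sub
    ((H.sqrt.affineDrift.integral_mem_wBounded hg).1.comp measurable_fst)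
  integral_eq_zero x := by
    have := H.isMarkovKernel
    simp only [centeredIncrement]
    rw [integral_sub (wBounded_integrable ⟨g, hg⟩ (H.sqrt.affineDrift.integrable_kernel x))
      (integrable_const _), integral_const, probReal_univ, one_smul, sub_self]
  memLp n := (hΦ.memLp_comp H.affineDrift hμ (n + 1) hg).sub
    (hΦ.memLp_comp H.affineDrift hμ n (H.sqrt.affineDrift.integral_mem_wBounded hg))

lemma IsMartingaleIncrement.integral_mul_centeredIncrement (hu : IsMartingaleIncrement Pr κ Φ u)
    (k : ℕ) :
    ∫ ω, u (Φ k ω, Φ (k + 1) ω) * centeredIncrement κ g (Φ k ω, Φ (k + 1) ω) ∂Pr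
      = ∫ ω, ∫ y, g y * u (Φ k ω, y) ∂(κ (Φ k ω)) ∂Pr := by
  have := H.isMarkovKernel
  have hPg := H.sqrt.affineDrift.integral_mem_wBounded hg
  have hPgL := hΦ.memLp_comp H.affineDrift hμ k hPg
  have hgu : Integrable (fun ω => g (Φ (k + 1) ω) * u (Φ k ω, Φ (k + 1) ω)) Pr :=
    (hΦ.memLp_comp H.affineDrift hμ (k + 1) hg).integrable_mul (hu.memLp k)
  have hPgu : Integrable
      (fun ω => (∫ y, g y ∂(κ (Φ k ω))) * u (Φ k ω, Φ (k + 1) ω)) Pr :=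
    hPgL.integrable_mul (hu.memLp k)
  simp only [centeredIncrement, mul_comm (u _), sub_mul]
  have hPgu0 : ∫ ω, (∫ y, g y ∂(κ (Φ k ω))) * u (Φ k ω, Φ (k + 1) ω) ∂Pr = 0 :=
    hu.integral_mul_eq_zero hΦ (hPg.1.comp (measurable_history Φ le_rfl)) hPgL
  rw [integral_sub hgu hPgu, hPgu0, sub_zero]
  exact hΦ.integral_pair k (u := fun z => g z.2 * u z)
    ((hg.1.comp measurable_snd).mul hu.measurable) hgu

theorem IsMartingaleIncrement.integral_sum_comp_mul_incrementSum {φ : X → ℝ} {c : ℝ}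
    (hP : ∀ x, g x - ∫ y, g y ∂(κ x) = φ x - c) (hu : IsMartingaleIncrement Pr κ Φ u) (n : ℕ) :
    ∫ ω, (∑ j ∈ Finset.range n, φ (Φ j ω)) * incrementSum Φ u n ω ∂Pr
      = ∑ k ∈ Finset.range n, ∫ ω, ∫ y, g y * u (Φ k ω, y) ∂(κ (Φ k ω)) ∂Pr
        - ∫ ω, g (Φ n ω) * incrementSum Φ u n ω ∂Pr := by
  have := H.isMarkovKernel
  have hD := isMartingaleIncrement_centeredIncrement H hΦ hμ hg
  have hgL (k : ℕ) : MemLp (fun ω => g (Φ k ω)) 2 Pr := hΦ.memLp_comp H.affineDrift hμ k hg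
  have hinitL : MemLp (fun ω => n * c + g (Φ 0 ω)) 2 Pr := (memLp_const (n * c)).add (hgL 0)
  have hinit : Integrable (fun ω => (n * c + g (Φ 0 ω)) * incrementSum Φ u n ω) Pr :=
    hinitL.integrable_mul (hu.memLp_incrementSum n)
  have hlast : Integrable (fun ω => g (Φ n ω) * incrementSum Φ u n ω) Pr :=
    (hgL n).integrable_mul (hu.memLp_incrementSum n)
  have hmart : Integrable (fun ω => incrementSum Φ u n ω *
      incrementSum Φ (centeredIncrement κ g) n ω) Pr :=
    (hu.memLp_incrementSum n).integrable_mul (hD.memLp_incrementSum n)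
  have hinit0 : ∫ ω, (n * c + g (Φ 0 ω)) * incrementSum Φ u n ω ∂Pr = 0 :=
    hu.integral_initial_mul_incrementSum_eq_zero hΦ (hg.1.const_add (n * c)) hinitL n
  have hcross : ∫ ω, incrementSum Φ u n ω * incrementSum Φ (centeredIncrement κ g) n ω ∂Pr
      = ∑ k ∈ Finset.range n, ∫ ω, ∫ y, g y * u (Φ k ω, y) ∂(κ (Φ k ω)) ∂Pr :=
    (hu.integral_incrementSum_mul hD hΦ n).trans
      (Finset.sum_congr rfl fun k _ => hu.integral_mul_centeredIncrement H hΦ hμ hg k)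
  have hdiff : Integrable (fun ω => (n * c + g (Φ 0 ω)) * incrementSum Φ u n ω
      - g (Φ n ω) * incrementSum Φ u n ω) Pr := hinit.sub hlast
  have hexpand (ω : Ω) : (∑ j ∈ Finset.range n, φ (Φ j ω)) * incrementSum Φ u n ω
      = (n * c + g (Φ 0 ω)) * incrementSum Φ u n ω - g (Φ n ω) * incrementSum Φ u n ω
        + incrementSum Φ u n ω * incrementSum Φ (centeredIncrement κ g) n ω := by
    rw [sum_comp_eq_add_incrementSum hP]
    ring
  simp_rw [hexpand]
  rw [integral_add hdiff hmart, integral_sub hinit hlast, hinit0, hcross]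
  ring

end Drift

end MartingaleIncrement

section Score

variable {d : ℕ}

lemma partialDeriv_prod_of_eq_one {ι : Type*} (s : Finset ι) (i : Fin d) {θ₀ : Fin d → ℝ}
    {F : ι → (Fin d → ℝ) → ℝ} (hF : ∀ j ∈ s, HasGradientAt (F j) θ₀)
    (hone : ∀ j ∈ s, F j θ₀ = 1) :
    partialDeriv i (fun θ => ∏ j ∈ s, F j θ) θ₀ = ∑ j ∈ s, partialDeriv i (F j) θ₀ := by
  classical
  have hprod : HasLineDerivAt ℝ (fun θ => ∏ j ∈ s, F j θ) _ θ₀ (Pi.single i 1) :=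
    HasDerivAt.fun_finsetProd (u := s) (f := fun j (t : ℝ) => F j (θ₀ + t • Pi.single i 1))
      (x := 0) fun j hj => (hF j hj i).hasLineDerivAt
  rw [partialDeriv, hprod.lineDeriv]
  refine Finset.sum_congr rfl fun j _ => ?_
  have hothers : ∏ k ∈ s.erase j, F k (θ₀ + (0 : ℝ) • Pi.single i 1) = 1 :=
    Finset.prod_eq_one fun k hk => by simpa using hone k (Finset.mem_of_mem_erase hk)
  rw [hothers, one_smul, partialDeriv]

/-- The score function `∂_i log p(θ₀, x, y)`, as a function of the pair `(x, y)`. The logarithm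
is not needed because `p(θ₀, x, y) = 1`. -/
def score (p : (Fin d → ℝ) → X → X → ℝ) (θ₀ : Fin d → ℝ) (i : Fin d) (z : X × X) : ℝ :=
  partialDeriv i (fun θ => p θ z.1 z.2) θ₀

/-- The `i`-th diagonal entry `g_ii` of the conditional Fisher information. -/
def fisherInformation (P : (Fin d → ℝ) → Kernel X X) (p : (Fin d → ℝ) → X → X → ℝ)
    (θ₀ : Fin d → ℝ) (i : Fin d) (x : X) : ℝ≥0∞ :=
  ∫⁻ y, ENNReal.ofReal (score p θ₀ i (x, y) ^ 2) ∂(P θ₀ x)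

variable {Ω : Type*} [MeasurableSpace Ω] {Pr : Measure Ω} [IsProbabilityMeasure Pr]
  {μ : Measure X} {Φ : ℕ → Ω → X}

lemma IsMarkovChain.memLp_timeAverage {κ : Kernel X X} {V φ : X → ℝ} {lam C : ℝ}
    (hΦ : IsMarkovChain Pr κ μ Φ) (H : AffineDrift κ V lam C) (hμ : Integrable V μ)
    (hφ : φ ∈ wBounded fun x => √(V x)) (n : ℕ) : MemLp (timeAverage φ Φ n) 2 Pr :=
  (memLp_finsetSum _ fun k _ => hΦ.memLp_comp H hμ k hφ).const_mul _

namespace DifferentiableDriftFamily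

variable {Θ : Set (Fin d → ℝ)} {P : (Fin d → ℝ) → Kernel X X} {p : (Fin d → ℝ) → X → X → ℝ}
  {θ₀ : Fin d → ℝ} {ε : ℝ} {V : X → ℝ} {lam b : ℝ}
  (hA : DifferentiableDriftFamily Θ P p θ₀ ε V lam b)
include hA

lemma density_eq_one (x : X) : ∀ᵐ y ∂(P θ₀ x), p θ₀ x y = 1 := by
  have := hA.isMarkovKernel
  have hmeas : Measurable fun y => ENNReal.ofReal (p θ₀ x y) :=
    ((hA.density_measurable θ₀ hA.mem_box).comp measurable_prodMk_left).ennreal_ofReal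
  have hdensity : (P θ₀ x).withDensity (fun y => ENNReal.ofReal (p θ₀ x y))
      = (P θ₀ x).withDensity 1 := by
    rw [withDensity_one]
    exact (hA.density θ₀ hA.mem_box x).symm
  filter_upwards [(withDensity_eq_iff_of_sigmaFinite hmeas.aemeasurable aemeasurable_one).1
    hdensity] with y hy
  exact ENNReal.ofReal_eq_one.1 hy

variable (hΦ : IsMarkovChain Pr (P θ₀) μ Φ)
include hΦ

lemma grad_likelihoodRatio (i : Fin d) (n : ℕ) : ∀ᵐ ω ∂Pr,
    grad (fun θ => likelihoodRatio p Φ n θ ω) θ₀ i = incrementSum Φ (score p θ₀ i) n ω := by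
  have := hA.isMarkovKernel
  have hone : ∀ᵐ ω ∂Pr, ∀ k, p θ₀ (Φ k ω) (Φ (k + 1) ω) = 1 :=
    ae_all_iff.2 fun k => hΦ.ae_pair k (q := fun z => p θ₀ z.1 z.2 = 1)
      (hA.density_measurable θ₀ hA.mem_box (measurableSet_singleton 1)) hA.density_eq_one
  filter_upwards [hone] with ω hω
  exact partialDeriv_prod_of_eq_one (Finset.range n) i
    (F := fun j θ => p θ (Φ j ω) (Φ (j + 1) ω))
    (fun _ _ => hA.density_differentiable _ _) fun j _ => hω j

variable (hμ : Integrable V μ)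
include hμ

lemma lintegral_score_sq_le (i : Fin d) (k : ℕ) :
    ∫⁻ ω, ENNReal.ofReal (score p θ₀ i (Φ k ω, Φ (k + 1) ω) ^ 2) ∂Pr
      ≤ wnorm V (fisherInformation P p θ₀ i)
        * ENNReal.ofReal (∫ x, V x ∂μ + b / (1 - lam)) := by
  have := hA.isMarkovKernel
  have H := hA.affineDrift hA.mem_box
  have hVk := hΦ.integrable_weight_comp H hμ k
  have hfisher : wnorm V (fisherInformation P p θ₀ i) ≠ ∞ := (hA.fisher_bounded i).ne
  calc ∫⁻ ω, ENNReal.ofReal (score p θ₀ i (Φ k ω, Φ (k + 1) ω) ^ 2) ∂Pr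
      = ∫⁻ ω, fisherInformation P p θ₀ i (Φ k ω) ∂Pr :=
        hΦ.lintegral_pair k (u := fun z => ENNReal.ofReal (score p θ₀ i z ^ 2))
          ((hA.measurable_partialDeriv i).pow_const 2).ennreal_ofReal
    _ ≤ ∫⁻ ω, wnorm V (fisherInformation P p θ₀ i) * ENNReal.ofReal (V (Φ k ω)) ∂Pr :=
        lintegral_mono fun ω => le_wnorm_mul hA.isWeight.pos _ (Φ k ω)
    _ = wnorm V (fisherInformation P p θ₀ i) * ENNReal.ofReal (∫ ω, V (Φ k ω) ∂Pr) := by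
        rw [lintegral_const_mul' _ _ hfisher,
          ofReal_integral_eq_lintegral_ofReal hVk (ae_of_all _ fun ω => (hA.isWeight.pos _).le)]
    _ ≤ _ := by
        gcongr
        exact hΦ.integral_weight_comp_le H hμ hA.lam_lt_one k

lemma isMartingaleIncrement_score (i : Fin d) :
    IsMartingaleIncrement Pr (P θ₀) Φ (score p θ₀ i) where
  measurable := hA.measurable_partialDeriv i
  integral_eq_zero := hA.integral_partialDeriv_eq_zero i
  memLp k := by
    have hmeas : Measurable fun ω => score p θ₀ i (Φ k ω, Φ (k + 1) ω) :=
      (hA.measurable_partialDeriv i).comp (hΦ.measurable_pair k)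
    refine (memLp_two_iff_integrable_sq hmeas.aestronglyMeasurable).2
      ⟨(hmeas.pow_const 2).aestronglyMeasurable, ?_⟩
    rw [hasFiniteIntegral_iff_ofReal (ae_of_all _ fun ω => sq_nonneg _)]
    exact (hA.lintegral_score_sq_le hΦ hμ i k).trans_lt
      (ENNReal.mul_lt_top (hA.fisher_bounded i) ENNReal.ofReal_lt_top)

lemma exists_integral_score_sq_le (i : Fin d) :
    ∃ C, ∀ k, ∫ ω, score p θ₀ i (Φ k ω, Φ (k + 1) ω) ^ 2 ∂Pr ≤ C := by
  refine ⟨(wnorm V (fisherInformation P p θ₀ i)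
    * ENNReal.ofReal (∫ x, V x ∂μ + b / (1 - lam))).toReal, fun k => ?_⟩
  have hmeas : Measurable fun ω => score p θ₀ i (Φ k ω, Φ (k + 1) ω) :=
    (hA.measurable_partialDeriv i).comp (hΦ.measurable_pair k)
  rw [integral_eq_lintegral_of_nonneg_ae (ae_of_all _ fun ω => sq_nonneg _)
    (hmeas.pow_const 2).aestronglyMeasurable]
  exact ENNReal.toReal_mono
    (ENNReal.mul_lt_top (hA.fisher_bounded i) ENNReal.ofReal_lt_top).ne
    (hA.lintegral_score_sq_le hΦ hμ i k)

lemma integrable_timeAverage_mul_grad {f : X → ℝ} (hf : f ∈ wBounded fun x => √(V x)) (n : ℕ)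
    (i : Fin d) : Integrable (fun ω =>
      timeAverage f Φ n ω * grad (fun θ => likelihoodRatio p Φ n θ ω) θ₀ i) Pr := by
  have hscore : Integrable (fun ω => timeAverage f Φ n ω * incrementSum Φ (score p θ₀ i) n ω) Pr :=
    (hΦ.memLp_timeAverage (hA.affineDrift hA.mem_box) hμ hf n).integrable_mul
      ((hA.isMartingaleIncrement_score hΦ hμ i).memLp_incrementSum n)
  refine hscore.congr ?_
  filter_upwards [hA.grad_likelihoodRatio hΦ i n] with ω hω
  rw [hω]

lemma integral_timeAverage_mul_score {f g : X → ℝ} {c : ℝ} (hg : g ∈ wBounded fun x => √(V x))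
    (hP : ∀ x, g x - ∫ y, g y ∂(P θ₀ x) = f x - c) (i : Fin d) (n : ℕ) :
    ∫ ω, timeAverage f Φ n ω * incrementSum Φ (score p θ₀ i) n ω ∂Pr
      = (1 / (n : ℝ)) * ∑ k ∈ Finset.range n, ∫ ω, derivKernel P p θ₀ i g (Φ k ω) ∂Pr
        - (1 / (n : ℝ)) * ∫ ω, g (Φ n ω) * incrementSum Φ (score p θ₀ i) n ω ∂Pr := by
  obtain ⟨K, δ, m, ν, H⟩ := hA.driftMinorization θ₀ hA.mem_box
  have hscore := hA.isMartingaleIncrement_score hΦ hμ i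
  simp only [timeAverage, mul_assoc, integral_const_mul]
  rw [hscore.integral_sum_comp_mul_incrementSum H hΦ hμ hg hP, mul_sub]
  rfl

lemma tendsto_inv_mul_integral_mul_score (i : Fin d) {g : X → ℝ}
    (hg : g ∈ wBounded fun x => √(V x)) :
    Tendsto (fun n : ℕ => (1 / (n : ℝ))
      * ∫ ω, g (Φ n ω) * incrementSum Φ (score p θ₀ i) n ω ∂Pr) atTop (𝓝 0) := by
  have := hA.isMarkovKernel
  have H := hA.affineDrift hA.mem_box
  have hscore := hA.isMartingaleIncrement_score hΦ hμ i
  obtain ⟨C, hC⟩ := hA.exists_integral_score_sq_le hΦ hμ i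
  obtain ⟨M, hM0, hM⟩ := hA.isWeight.exists_abs_le ⟨_, hA.isWeight.sq_mem_wBounded hg⟩
  exact tendsto_inv_mul_integral_mul_zero (fun n => hΦ.memLp_comp H hμ n hg)
    hscore.memLp_incrementSum
    (fun n => (le_abs_self _).trans (hΦ.abs_integral_comp_le H hμ hA.lam_lt_one n hM0 hM))
    (hscore.integral_incrementSum_sq_le hΦ hC)

theorem tendsto_integral_timeAverage_mul_score [Nonempty X] (i : Fin d) {f g : X → ℝ} {c : ℝ}
    (hg : g ∈ wBounded fun x => √(V x)) (hP : ∀ x, g x - ∫ y, g y ∂(P θ₀ x) = f x - c) :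
    Tendsto (fun n : ℕ => ∫ ω, timeAverage f Φ n ω * incrementSum Φ (score p θ₀ i) n ω ∂Pr) atTop
      (𝓝 (steadyState P (derivKernel P p θ₀ i g) θ₀)) := by
  obtain ⟨K, δ, m, ν, H⟩ := hA.driftMinorization θ₀ hA.mem_box
  have hst := hA.isStationary_stationary hA.mem_box
  have := hst.1
  have hlim := (hΦ.tendsto_average_integral_comp H hμ hst.2
      (hA.derivKernel_mem_wBounded i (hA.isWeight.wBounded_sqrt_le hg))).sub
    (hA.tendsto_inv_mul_integral_mul_score hΦ hμ i hg)
  rw [sub_zero] at hlim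
  exact hlim.congr fun n => (hA.integral_timeAverage_mul_score hΦ hμ hg hP i n).symm

end DifferentiableDriftFamily

end Score

end

end LRGradient

open LRGradient in
theorem theoremT_general {X Ω : Type*} [MeasurableSpace X] [MeasurableSpace Ω] {d : ℕ}
    (Θ : Set (Fin d → ℝ)) (P : (Fin d → ℝ) → Kernel X X) (p : (Fin d → ℝ) → X → X → ℝ)
    (θ₀ : Fin d → ℝ) (ε : ℝ) (V : X → ℝ) (lam b : ℝ) (f : X → ℝ)
    (hA : DifferentiableDriftFamily Θ P p θ₀ ε V lam b) (hf : f ∈ wBounded fun x => √(V x))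
    (Pr : Measure Ω) [IsProbabilityMeasure Pr] (μ : Measure X) (Φ : ℕ → Ω → X)
    (hΦ : IsMarkovChain Pr (P θ₀) μ Φ) (hμ : Integrable V μ) :
    (∀ θ ∈ box Θ θ₀ ε, (∃! π : Measure X, IsStationary (P θ) π) ∧
      Integrable f (stationary (P θ))) ∧
    HasGradientAt (steadyState P f) θ₀ ∧
    (∀ (n : ℕ) (i : Fin d), Integrable (fun ω =>
      timeAverage f Φ n ω * grad (fun θ => likelihoodRatio p Φ n θ ω) θ₀ i) Pr) ∧
    Tendsto (fun (n : ℕ) (i : Fin d) => ∫ ω,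
        timeAverage f Φ n ω * grad (fun θ => likelihoodRatio p Φ n θ ω) θ₀ i ∂Pr)
      atTop (𝓝 (grad (steadyState P f) θ₀)) := by
  have : Nonempty X := (nonempty_of_isProbabilityMeasure Pr).map (Φ 0)
  have hfV : f ∈ wBounded V := hA.isWeight.wBounded_sqrt_le hf
  have hst := hA.isStationary_stationary hA.mem_box
  have := hst.1
  obtain ⟨K, δ, m, ν, H⟩ := hA.driftMinorization θ₀ hA.mem_box
  obtain ⟨g, hg, hP⟩ := H.sqrt.exists_poisson hst.2 hf
  have hderiv (i : Fin d) :=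
    hA.hasLineDerivAt_steadyState i hfV (hA.isWeight.wBounded_sqrt_le hg) hP
  refine ⟨fun θ hθ => ⟨hA.existsUnique_stationary hθ, hA.integrable_stationary hθ hfV⟩,
    fun i => (hderiv i).lineDifferentiableAt, hA.integrable_timeAverage_mul_grad hΦ hμ hf,
    tendsto_pi_nhds.2 fun i => ?_⟩
  have hgrad : grad (steadyState P f) θ₀ i = steadyState P (derivKernel P p θ₀ i g) θ₀ :=
    (hderiv i).lineDeriv
  rw [hgrad]
  refine (hA.tendsto_integral_timeAverage_mul_score hΦ hμ i hg hP).congr fun n =>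
    integral_congr_ae ?_
  filter_upwards [hA.grad_likelihoodRatio hΦ i n] with ω hω
  rw [hω]

open LRGradient in
theorem theoremT {X Ω : Type*} [MeasurableSpace X] [MeasurableSpace.CountablyGenerated X]
    [MeasurableSpace Ω] {d : ℕ}
    (Θ : Set (Fin d → ℝ)) (P : (Fin d → ℝ) → Kernel X X) (p : (Fin d → ℝ) → X → X → ℝ)
    (θ₀ : Fin d → ℝ) (ε : ℝ) (K : Set X) (δ : ℝ) (m : ℕ) (ν : Measure X)
    (V : X → ℝ) (lam b : ℝ) (f : X → ℝ)
    (hA : StandingAssumption Θ P p θ₀ ε K δ m ν V lam b f)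
    (Pr : Measure Ω) [IsProbabilityMeasure Pr] (μ : Measure X) (Φ : ℕ → Ω → X)
    (hΦ : IsMarkovChain Pr (P θ₀) μ Φ) (hμ : Integrable V μ) :
    -- `π(θ)` and `α(θ) = π(θ) f` are well defined near `θ₀`
    (∀ θ ∈ box Θ θ₀ ε, (∃! π : Measure X, IsStationary (P θ) π) ∧
      Integrable f (stationary (P θ))) ∧
    -- the gradient of `α` exists at `θ₀`
    HasGradientAt (steadyState P f) θ₀ ∧
    -- the finite-horizon expectations are well defined and converge to the gradient
    (∀ (n : ℕ) (i : Fin d), Integrable (fun ω =>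
      timeAverage f Φ n ω * grad (fun θ => likelihoodRatio p Φ n θ ω) θ₀ i) Pr) ∧
    Tendsto (fun (n : ℕ) (i : Fin d) => ∫ ω,
        timeAverage f Φ n ω * grad (fun θ => likelihoodRatio p Φ n θ ω) θ₀ i ∂Pr)
      atTop (𝓝 (grad (steadyState P f) θ₀)) :=
  theoremT_general Θ P p θ₀ ε V lam (max b 1) f hA.differentiableDriftFamily hA.f_mem Pr μ Φ hΦ hμ
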